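/- Let $k\ge 2$ and $\gamma>1$ be constants. \textbf{Setting.} For $n\ge 1$ let $p_{i,j}\in[0,1]$ ($1\le i\ne j\le n$) satisfy $p_{j,i}=1-p_{i,j}$. The set $\{p_{i,j}\}$ is \emph{weakly monotonic} if (1) $p_{i,j}\ge 1/2$ for all $i<j$, and either (2) $p_{i,j+1}\ge p_{i,j}$ for all $1\le i<j\le n-1$, or (3) $p_{i-1,j}\ge p_{i,j}$ for all $2\le i<j\le n$. It forms a \emph{$k$-class} if $[n]$ is partitioned into non-empty consecutive intervals $C_1<C_2<\dots<C_k$, $p_{x,y}=1/2$ for distinct $x,y$ in the same class, and for $a\ne b$ the value $p_{x,y}=:q_{a,b}$ is the same for all $x\in C_a$, $y\in C_b$; put $q_{a,a}=1/2$. The $k$-class is \emph{bounded} (with constant $\gamma$) if $p_{i,j}/p_{j,i}\ge\gamma$ for all $i<j$ in different classes. Let $c_a=|C_a|$ and $\lambda_{a,b}=q_{a,b}/q_{b,a}$. A \emph{$k$-particle system} is a word $x\in\{1,\dots,k\}^n$ that contains each letter $a$ exactly $c_a$ times; $\Omega$ is the set of these words, with the distribution $\pi(x)=Z^{-1}\prod_{i<j}q_{x_i,x_j}$,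 where $Z$ is the normalizing constant. \textbf{The $k$-particle process $\mathcal M_{k+1}$.} If (2) holds, it is the following Markov chain on $\Omega$. From $x$, choose a position $i\in\{1,\dots,n\}$ and a direction $d\in\{L,R\}$ uniformly at random. If $d=L$, find the largest $j<i$ with $x_j\ge x_i$; if it exists and $x_j>x_i$, exchange $x_i$ and $x_j$. If $d=R$, find the smallest $j>i$ with $x_j\ge x_i$; if it exists and $x_j>x_i$, exchange $x_i$ and $x_j$ with probability $\lambda_{x_j,x_i}\prod_{i<m<j}\lambda_{x_j,x_m}\lambda_{x_m,x_i}$. Otherwise do nothing. If (3) holds, it is the mirror image, which swaps across larger instead of smaller classes: if $d=R$, find the smallest $j>i$ with $x_j\le x_i$; if it exists and $x_j<x_i$, exchange $x_i$ and $x_j$. If $d=L$, find the largest $j<i$ with $x_j\le x_i$; if it exists and $x_j<x_i$, exchange $x_i$ and $x_j$ with probability $\lambda_{x_i,x_j}\prod_{j<m<i}\lambda_{x_i,x_m}\lambda_{x_m,x_j}$. Otherwise do nothing. (If both (2) and (3) hold, the claims below are made for both chains.) Let $P_{k+1}$ be the transition matrix. Let $\mathrm{Gap}(P_{k+1})=1-|\lambda_1|$,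 where $|\lambda_1|$ is the largest absolute value among the eigenvalues of $P_{k+1}$ (with multiplicity) after one eigenvalue $1$ is removed, and let $\tau_{k+1}(\epsilon)=\min\{t:\ \max_x\tfrac12\sum_y|P_{k+1}^{t'}(x,y)-\pi(y)|\le\epsilon\ \ \forall t'\ge t\}$. \textbf{Claim.} (i) There is a constant $A>0$ depending only on $k$ and $\gamma$ such that for every $n$ and every weakly monotonic $k$-class on $[n]$ that is bounded with constant $\gamma$, $$\mathrm{Gap}(P_{k+1})\ \ge\ A\Big(n^{k-1}\prod_{i=1}^{k-1}(c_i+\ln n)\Big)^{-1}.$$ (ii) For every $\epsilon_0\in(0,1)$ there is a constant $B>0$ depending only on $k$, $\gamma$ and $\epsilon_0$ such that for all such $n$ and $k$-classes and all $0<\epsilon\le\epsilon_0$, $\tau_{k+1}(\epsilon)$ is finite and $$\tau_{k+1}(\epsilon)\ \le\ B\,n^{2k}\ln\epsilon^{-1}.$$ -/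

import Mathlib

namespace KParticle

open Finset

/-! ### Sets of probabilities and bounded `k`-classes

Elements, positions and classes are indexed from `0`. -/

/-- A set of probabilities `p i j`, for `i ≠ j`, with `p j i = 1 - p i j`. -/
structure IsProbSet {n : ℕ} (p : Fin n → Fin n → ℝ) : Prop where
  nonneg : ∀ i j, i ≠ j → 0 ≤ p i j
  le_one : ∀ i j, i ≠ j → p i j ≤ 1
  symm : ∀ i j, i ≠ j → p j i = 1 - p i j

/-- `p i j ≥ 1/2` for all `i < j`. -/
def PositivelyBiased {n : ℕ} (p : Fin n → Fin n → ℝ) : Prop :=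
  ∀ i j, i < j → 1 / 2 ≤ p i j

/-- `p i (j+1) ≥ p i j` for all `i < j`. -/
def MonotoneRight {n : ℕ} (p : Fin n → Fin n → ℝ) : Prop :=
  ∀ i j j' : Fin n, i < j → (j' : ℕ) = j + 1 → p i j ≤ p i j'

/-- `p (i-1) j ≥ p i j` for all `i < j`. -/
def MonotoneLeft {n : ℕ} (p : Fin n → Fin n → ℝ) : Prop :=
  ∀ i i' j : Fin n, i < j → (i : ℕ) = i' + 1 → p i j ≤ p i' j

/-- Weak monotonicity. -/
def WeaklyMonotonic {n : ℕ} (p : Fin n → Fin n → ℝ) : Prop :=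
  PositivelyBiased p ∧ (MonotoneRight p ∨ MonotoneLeft p)

/-- `p` forms a `k`-class: `C` sends an element to its class, the classes are non-empty
consecutive intervals, elements of the same class interact with probability `1/2`, and
`p x y` is the number `q a b` whenever `x` and `y` are in the classes `a` and `b`. -/
structure IsKClass {n k : ℕ} (p : Fin n → Fin n → ℝ) (C : Fin n → Fin k)
    (q : Fin k → Fin k → ℝ) : Prop where
  mono : Monotone C
  surj : Function.Surjective C
  half : ∀ a, q a a = 1 / 2
  eq : ∀ x y, x ≠ y → p x y = q (C x) (C y)

/-- The `k`-class is bounded with constant `γ`. (A zero denominator makes the quotient `0`,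
so for `γ > 1` it is excluded.) -/
def BoundedBy {n k : ℕ} (γ : ℝ) (p : Fin n → Fin n → ℝ) (C : Fin n → Fin k) : Prop :=
  ∀ i j, i < j → C i ≠ C j → γ ≤ p i j / p j i

/-- The number `c_a` of elements of class `a`. -/
def classSize {n k : ℕ} (C : Fin n → Fin k) (a : Fin k) : ℕ := #{i | C i = a}

/-! ### `k`-particle systems and their distribution -/

/-- A `k`-particle system: an arrangement `x` of class labels on the positions in which each
class `a` occurs `c_a` times. -/
abbrev ParticleSystem {n k : ℕ} (C : Fin n → Fin k) : Type :=
  {x : Fin n → Fin k // ∀ a, #{i | x i = a} = classSize C a}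

variable {n k : ℕ} {C : Fin n → Fin k}

/-- Exchange the particles at the positions `i` and `j`. -/
def exchange (x : ParticleSystem C) (i j : Fin n) : ParticleSystem C :=
  ⟨fun m => x.1 (Equiv.swap i j m), fun a => by
    rw [← x.2 a]
    exact Finset.card_equiv (Equiv.swap i j) (by simp)⟩

/-- The unnormalised weight `∏_{i<j} q (x i) (x j)`. -/
noncomputable def weight (q : Fin k → Fin k → ℝ) (x : ParticleSystem C) : ℝ :=
  ∏ i, ∏ j ∈ Ioi i, q (x.1 i) (x.1 j)

/-- The distribution `π` on `k`-particle systems. -/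
noncomputable def stationary (q : Fin k → Fin k → ℝ) (x : ParticleSystem C) : ℝ :=
  weight q x / ∑ y : ParticleSystem C, weight q y

/-! ### The `k`-particle process -/

/-- `λ_{a,b} = q a b / q b a`. -/
noncomputable def lam (q : Fin k → Fin k → ℝ) (a b : Fin k) : ℝ := q a b / q b a

/-- For `i < j`, the probability
`λ_{x j, x i} ∏_{i<m<j} λ_{x j, x m} λ_{x m, x i}`
with which an exchange that brings the particles at `i`, `j` out of order is accepted. -/
noncomputable def accept (q : Fin k → Fin k → ℝ) (x : ParticleSystem C) (i j : Fin n) : ℝ :=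
  lam q (x.1 j) (x.1 i) *
    ∏ m ∈ Ioo i j, (lam q (x.1 j) (x.1 m) * lam q (x.1 m) (x.1 i))

/-- The largest element of `s`, or `i` if there is none. -/
def largest (s : Finset (Fin n)) (i : Fin n) : Fin n := if h : s.Nonempty then s.max' h else i

/-- The smallest element of `s`, or `i` if there is none. -/
def smallest (s : Finset (Fin n)) (i : Fin n) : Fin n := if h : s.Nonempty then s.min' h else i

/-- The point mass at `x`. -/
def point (x y : ParticleSystem C) : ℝ := if x = y then 1 else 0

/-- With probability `a` exchange the particles at `i` and `j`, otherwise stay. -/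
noncomputable def tryExchange (x : ParticleSystem C) (i j : Fin n) (a : ℝ)
    (y : ParticleSystem C) : ℝ :=
  a * point (exchange x i j) y + (1 - a) * point x y

/-- Transition matrix of the `k`-particle process that swaps particles across particles of
smaller classes. A position `i` and a direction are chosen uniformly at random.
Left: for the largest `j < i` with `x j ≥ x i` (if any), exchange if `x j > x i`.
Right: for the smallest `j > i` with `x j ≥ x i` (if any), if `x j > x i`, exchange with
probability `accept q x i j`. Otherwise nothing changes. -/
noncomputable def processSmaller (C : Fin n → Fin k) (q : Fin k → Fin k → ℝ) :
    Matrix (ParticleSystem C) (ParticleSystem C) ℝ := fun x y =>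
  1 / (2 * (n : ℝ)) * ∑ i : Fin n,
    ((let j := largest {j | j < i ∧ x.1 i ≤ x.1 j} i
      if x.1 i < x.1 j then tryExchange x i j 1 y else point x y) +
     (let j := smallest {j | i < j ∧ x.1 i ≤ x.1 j} i
      if x.1 i < x.1 j then tryExchange x i j (accept q x i j) y else point x y))

/-- Transition matrix of the mirrored process that swaps particles across particles of
larger classes. A position `i` and a direction are chosen uniformly at random.
Right: for the smallest `j > i` with `x j ≤ x i` (if any), exchange if `x j < x i`.
Left: for the largest `j < i` with `x j ≤ x i` (if any), if `x j < x i`, exchange with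
probability `accept q x j i`. Otherwise nothing changes. -/
noncomputable def processLarger (C : Fin n → Fin k) (q : Fin k → Fin k → ℝ) :
    Matrix (ParticleSystem C) (ParticleSystem C) ℝ := fun x y =>
  1 / (2 * (n : ℝ)) * ∑ i : Fin n,
    ((let j := smallest {j | i < j ∧ x.1 j ≤ x.1 i} i
      if x.1 j < x.1 i then tryExchange x i j 1 y else point x y) +
     (let j := largest {j | j < i ∧ x.1 j ≤ x.1 i} i
      if x.1 j < x.1 i then tryExchange x i j (accept q x j i) y else point x y))

/-- `P` is the transition matrix of the `k`-particle process: swaps go across smaller classes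
if `p` is monotone in its second index, and across larger classes if it is monotone in its
first index. (If both hold, both processes are meant.) -/
def IsParticleProcess (p : Fin n → Fin n → ℝ) (C : Fin n → Fin k) (q : Fin k → Fin k → ℝ)
    (P : Matrix (ParticleSystem C) (ParticleSystem C) ℝ) : Prop :=
  (MonotoneRight p ∧ P = processSmaller C q) ∨ (MonotoneLeft p ∧ P = processLarger C q)

/-! ### Spectral gap and mixing time of a finite chain -/

section Chain

variable {S : Type*} [Fintype S] [DecidableEq S]

/-- `1 - |λ₁|`, where `|λ₁|` is the largest modulus among the eigenvalues of `P`, counted with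
multiplicity, after one eigenvalue `1` has been removed. -/
noncomputable def spectralGap (P : Matrix S S ℝ) : ℝ :=
  1 - ((((P.charpoly.aroots ℂ).erase 1).map fun z => ‖z‖₊).sup : NNReal)

/-- `max_x (1/2) ∑_y |P^t(x,y) - π(y)|`. -/
noncomputable def tvDist (P : Matrix S S ℝ) (π : S → ℝ) (t : ℕ) : ℝ :=
  ⨆ x, (1 / 2) * ∑ y, |(P ^ t) x y - π y|

/-- The times from which on the total variation distance is at most `ε`. -/
def mixedTimes (P : Matrix S S ℝ) (π : S → ℝ) (ε : ℝ) : Set ℕ :=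
  {t | ∀ t' ≥ t, tvDist P π t' ≤ ε}

/-- The mixing time; meaningful if `mixedTimes P π ε` is non-empty. -/
noncomputable def mixingTime (P : Matrix S S ℝ) (π : S → ℝ) (ε : ℝ) : ℕ :=
  sInf (mixedTimes P π ε)

end Chain

end KParticle

/-! The process is a walk on a lattice of heights. Label the particles class by class, from left to
right within a class; the height of a label is the number of particles of larger classes to its
left. Heights determine the system (`height_injective`), increase weakly along each class, and all
vanish exactly at the sorted word. A move across smaller classes changes a single height by one
(`processSmaller_eq_chain`): possible lowerings are always accepted, raisings with probability at
most `γ⁻¹ = u ^ 2`. The last bound is where weak monotonicity enters (`IsBiased.accept_le`). The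
process across larger classes is the same one after reversing positions and classes
(`processLarger_eq_submatrix`).

Gap. Join each state to the ground state by always lowering the first non-zero height. The
stationary weight loses a factor `u ^ 2` per unit of height; one `u` pays for Cauchy-Schwarz along
the path, the other for counting the paths through a given state `z`. If `i` is the first place
where `z` has positive height, the states whose path meets `z` agree with `z` beyond `i`, and before
`i` they are coded by the free increments of their heights. The weighted count is therefore at most
a product of geometric series, bounded in terms of `k` and `u` only (`sum_descendants_le`). This
yields a Poincaré constant of order `n` (`chain_poincareAt`). Since the holding probability is
bounded below, the absolute gap is at least a constant over `n`, which is more than the claim needs.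

Mixing. The bias has no upper bound, so the minimum of `π` can be arbitrarily small and the usual
`log (1 / min π)` estimate is useless. But the Poincaré inequality at the ground state `g` bounds `π
g` below (`one_le_mul_ground`), hence convergence holds from `g`. From any other state the walk
first has to hit `g`. By monotonicity in the heights this is no slower than for the walk with
constant acceptance `u ^ 2`, whose weights `u ^ (2 * total)` are under control because the total
height is at most `n ^ 2` (`survival_le`). Order `n ^ 3 + n * log ε⁻¹` steps suffice, within the
claimed `n ^ (2 * k) * log ε⁻¹`. -/

namespace KParticle

open Finset

/-! ### Reversible chains and their Dirichlet forms -/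

section Reversible

variable {S : Type*} [Fintype S]

/-- `P` is a stochastic matrix, reversible with respect to the positive distribution `π`. -/
structure IsReversible (P : Matrix S S ℝ) (π : S → ℝ) : Prop where
  nonneg : ∀ x y, 0 ≤ P x y
  row_sum : ∀ x, ∑ y, P x y = 1
  pos : ∀ x, 0 < π x
  sum_eq_one : ∑ x, π x = 1
  balance : ∀ x y, π x * P x y = π y * P y x

/-- The Dirichlet form `(1/2) ∑_{x,y} π(x) P(x,y) (f(x) - f(y))²`. -/
noncomputable def dirichlet (P : Matrix S S ℝ) (π f : S → ℝ) : ℝ :=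
  (1 / 2) * ∑ x, ∑ y, π x * P x y * (f x - f y) ^ 2

/-- Poincaré inequality with constant `R` for the functions that vanish at `g`. -/
def PoincareAt (P : Matrix S S ℝ) (π : S → ℝ) (g : S) (R : ℝ) : Prop :=
  ∀ f : S → ℝ, f g = 0 → ∑ x, π x * f x ^ 2 ≤ R * dirichlet P π f

variable {P : Matrix S S ℝ} {π : S → ℝ}

theorem dirichlet_sub_const (P : Matrix S S ℝ) (π f : S → ℝ) (c : ℝ) :
    dirichlet P π (fun x => f x - c) = dirichlet P π f := by
  simp [dirichlet]

theorem IsReversible.mul_self (h : IsReversible P π) : IsReversible (P * P) π where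
  nonneg x y := by
    rw [Matrix.mul_apply]
    exact sum_nonneg fun z _ => mul_nonneg (h.nonneg _ _) (h.nonneg _ _)
  row_sum x := by
    simp_rw [Matrix.mul_apply]
    rw [sum_comm]
    simp_rw [← mul_sum, h.row_sum, mul_one]
    exact h.row_sum x
  pos := h.pos
  sum_eq_one := h.sum_eq_one
  balance x y := by
    simp_rw [Matrix.mul_apply, mul_sum]
    refine sum_congr rfl fun z _ => ?_
    rw [← mul_assoc, h.balance x z, mul_comm (P y z), ← mul_assoc, mul_right_comm, h.balance z y]
    ring

theorem IsReversible.sum_mul_mulVec_comm (h : IsReversible P π) (f f' : S → ℝ) :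
    ∑ x, π x * (f x * (P.mulVec f') x) = ∑ x, π x * (P.mulVec f x * f' x) := by
  simp_rw [Matrix.mulVec, dotProduct, mul_sum, sum_mul, mul_sum]
  rw [sum_comm]
  refine sum_congr rfl fun y _ => sum_congr rfl fun x _ => ?_
  have := h.balance x y
  linear_combination f x * f' y * this

theorem IsReversible.sum_mul_mulVec (h : IsReversible P π) (f : S → ℝ) :
    ∑ x, π x * (P.mulVec f) x = ∑ x, π x * f x := by
  have := h.sum_mul_mulVec_comm (fun _ => 1) f
  simp only [one_mul] at this
  rw [this]
  refine sum_congr rfl fun x _ => ?_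
  simp [Matrix.mulVec, dotProduct, h.row_sum]

theorem IsReversible.dirichlet_eq (h : IsReversible P π) (f : S → ℝ) :
    dirichlet P π f = ∑ x, π x * f x ^ 2 - ∑ x, π x * (f x * (P.mulVec f) x) := by
  have e1 : ∑ x, ∑ y, π x * P x y * f x ^ 2 = ∑ x, π x * f x ^ 2 := by
    refine sum_congr rfl fun x _ => ?_
    rw [← sum_mul, ← mul_sum, h.row_sum, mul_one]
  have e2 : ∑ x, ∑ y, π x * P x y * f y ^ 2 = ∑ x, π x * f x ^ 2 := by
    rw [sum_comm, ← e1]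
    refine sum_congr rfl fun x _ => sum_congr rfl fun y _ => ?_
    rw [h.balance]
  have e3 : ∑ x, ∑ y, π x * P x y * (f x * f y) = ∑ x, π x * (f x * (P.mulVec f) x) := by
    refine sum_congr rfl fun x _ => ?_
    simp_rw [Matrix.mulVec, dotProduct, mul_sum]
    exact sum_congr rfl fun y _ => by ring
  have : ∑ x, ∑ y, π x * P x y * (f x - f y) ^ 2 =
      ∑ x, ∑ y, π x * P x y * f x ^ 2 + ∑ x, ∑ y, π x * P x y * f y ^ 2
        - 2 * ∑ x, ∑ y, π x * P x y * (f x * f y) := by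
    simp_rw [mul_sum, ← sum_add_distrib, ← sum_sub_distrib]
    exact sum_congr rfl fun x _ => sum_congr rfl fun y _ => by ring
  rw [dirichlet, this, e1, e2, e3]
  ring

/-- The left side is the pairing of `f` with `P * P` applied to `f`, so the loss is the Dirichlet
form of `P * P`. Holding before or after a move gives `(P * P) x y ≥ 2 * δ * P x y` off the
diagonal. This takes care of negative eigenvalues as well. -/
theorem IsReversible.sum_sq_mulVec_le [DecidableEq S] (h : IsReversible P π) {δ : ℝ}
    (hδ : ∀ x, δ ≤ P x x) (f : S → ℝ) :
    ∑ x, π x * (P.mulVec f) x ^ 2 ≤ ∑ x, π x * f x ^ 2 - 2 * δ * dirichlet P π f := by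
  have e1 : ∑ x, π x * (P.mulVec f) x ^ 2 = ∑ x, π x * (f x * ((P * P).mulVec f) x) := by
    rw [← Matrix.mulVec_mulVec, h.sum_mul_mulVec_comm]
    exact sum_congr rfl fun x _ => by ring
  have e2 : 2 * δ * dirichlet P π f ≤ dirichlet (P * P) π f := by
    rw [dirichlet, dirichlet, mul_left_comm, mul_sum]
    refine mul_le_mul_of_nonneg_left (sum_le_sum fun x _ => ?_) (by norm_num)
    rw [mul_sum]
    refine sum_le_sum fun y _ => ?_
    rcases eq_or_ne x y with rfl | hxy
    · simp
    have : 2 * δ * P x y ≤ (P * P) x y := by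
      rw [Matrix.mul_apply]
      have hle : ∑ z ∈ {x, y}, P x z * P z y ≤ ∑ z, P x z * P z y :=
        sum_le_sum_of_subset_of_nonneg (subset_univ _)
          fun z _ _ => mul_nonneg (h.nonneg _ _) (h.nonneg _ _)
      rw [sum_pair hxy] at hle
      nlinarith [hδ x, hδ y, h.nonneg x y]
    have h3 : 0 ≤ π x * (f x - f y) ^ 2 := mul_nonneg (h.pos x).le (sq_nonneg _)
    nlinarith
  have e3 := h.mul_self.dirichlet_eq f
  rw [e1]
  linarith

theorem IsReversible.variance_le (h : IsReversible P π) {f : S → ℝ}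
    (hf : ∑ x, π x * f x = 0) (c : ℝ) :
    ∑ x, π x * f x ^ 2 ≤ ∑ x, π x * (f x - c) ^ 2 := by
  have : ∑ x, π x * (f x - c) ^ 2 =
      ∑ x, π x * f x ^ 2 - 2 * c * ∑ x, π x * f x + c ^ 2 * ∑ x, π x := by
    simp_rw [mul_sum, ← sum_sub_distrib, ← sum_add_distrib]
    exact sum_congr rfl fun x _ => by ring
  rw [this, hf, h.sum_eq_one]
  nlinarith [sq_nonneg c]

theorem PoincareAt.le_of_sum_eq_zero {g : S} {R : ℝ} (h : IsReversible P π)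
    (hR : PoincareAt P π g R) {f : S → ℝ} (hf : ∑ x, π x * f x = 0) :
    ∑ x, π x * f x ^ 2 ≤ R * dirichlet P π f := by
  refine (h.variance_le hf (f g)).trans ?_
  rw [← dirichlet_sub_const P π f (f g)]
  exact hR _ (sub_self _)

/-! ### From a Poincaré inequality at one state to gap and convergence -/

section Contraction

variable [DecidableEq S] {g : S} {R δ : ℝ}

theorem IsReversible.sum_sq_mulVec_le_of_poincare (h : IsReversible P π) (hδ0 : 0 ≤ δ)
    (hδ : ∀ x, δ ≤ P x x) (hR0 : 0 < R) {f : S → ℝ}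
    (hf : ∑ x, π x * f x ^ 2 ≤ R * dirichlet P π f) :
    ∑ x, π x * (P.mulVec f) x ^ 2 ≤ (1 - δ / R) ^ 2 * ∑ x, π x * f x ^ 2 := by
  refine (h.sum_sq_mulVec_le hδ f).trans ?_
  set A := ∑ x, π x * f x ^ 2
  have hA : 0 ≤ A := sum_nonneg fun x _ => mul_nonneg (h.pos x).le (sq_nonneg _)
  have h1 : A / R ≤ dirichlet P π f := by rwa [div_le_iff₀' hR0]
  have h2 : 2 * δ * (A / R) ≤ 2 * δ * dirichlet P π f := by gcongr
  have h3 : (1 - δ / R) ^ 2 * A = A - 2 * δ * (A / R) + (δ / R) ^ 2 * A := by ring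
  have h4 : 0 ≤ (δ / R) ^ 2 * A := by positivity
  linarith

theorem IsReversible.pow_mulVec_sq_le (h : IsReversible P π) (hδ0 : 0 ≤ δ)
    (hδ : ∀ x, δ ≤ P x x) (hR0 : 0 < R) (hR : PoincareAt P π g R) {f : S → ℝ}
    (hf : ∑ x, π x * f x = 0) (t : ℕ) :
    ∑ x, π x * (P ^ t).mulVec f x = 0 ∧
      ∑ x, π x * ((P ^ t).mulVec f) x ^ 2 ≤ ((1 - δ / R) ^ 2) ^ t * ∑ x, π x * f x ^ 2 := by
  induction t with
  | zero => simp [hf]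
  | succ t ih =>
    have e : (P ^ (t + 1)).mulVec f = P.mulVec ((P ^ t).mulVec f) := by
      rw [Matrix.mulVec_mulVec, pow_succ']
    rw [e, h.sum_mul_mulVec]
    refine ⟨ih.1, (h.sum_sq_mulVec_le_of_poincare hδ0 hδ hR0
      (hR.le_of_sum_eq_zero h ih.1)).trans ?_⟩
    rw [pow_succ' _ t, mul_assoc]
    exact mul_le_mul_of_nonneg_left ih.2 (sq_nonneg _)

theorem IsReversible.eq_zero_of_mulVec_eq (h : IsReversible P π) (hδ0 : 0 < δ)
    (hδ : ∀ x, δ ≤ P x x) (hδR : δ ≤ R) (hR : PoincareAt P π g R) {f : S → ℝ}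
    (hf : ∑ x, π x * f x = 0) (hPf : P.mulVec f = f) : f = 0 := by
  have hR0 : 0 < R := hδ0.trans_le hδR
  have h1 := h.sum_sq_mulVec_le_of_poincare hδ0.le hδ hR0 (hR.le_of_sum_eq_zero h hf)
  rw [hPf] at h1
  have h0 : ∀ x ∈ univ, 0 ≤ π x * f x ^ 2 :=
    fun x _ => mul_nonneg (h.pos x).le (sq_nonneg _)
  have hA : 0 ≤ ∑ x, π x * f x ^ 2 := sum_nonneg h0
  have hq0 : 0 < δ / R := by positivity
  have hq1 : δ / R ≤ 1 := (div_le_one hR0).2 hδR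
  have hA0 : ∑ x, π x * f x ^ 2 = 0 := by
    have hlt : (1 - δ / R) ^ 2 < 1 := by nlinarith
    nlinarith
  rw [sum_eq_zero_iff_of_nonneg h0] at hA0
  funext x
  have := hA0 x (mem_univ x)
  simpa [(h.pos x).ne'] using this

/-- The gap discards a single copy of the eigenvalue 1, so algebraic multiplicity matters. The map
`P - 1` preserves mean zero and is injective there; after subtracting its mean, a generalized
eigenvector for 1 must vanish. -/
theorem IsReversible.rootMultiplicity_le_one (h : IsReversible P π) (hδ0 : 0 < δ)
    (hδ : ∀ x, δ ≤ P x x) (hδR : δ ≤ R) (hR : PoincareAt P π g R) :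
    P.charpoly.rootMultiplicity 1 ≤ 1 := by
  have e := LinearMap.finrank_maxGenEigenspace_eq (Matrix.toLin' P) 1
  rw [Matrix.charpoly_toLin'] at e
  rw [← e]
  have hstep : ∀ (m : ℕ) (w : S → ℝ), ∑ x, π x * w x = 0 →
      ((Matrix.toLin' P - 1) ^ m) w = 0 → w = 0 := by
    intro m
    induction m with
    | zero => intro w _ hw; simpa using hw
    | succ m ih =>
      intro w hw0 hw
      have h1 : (Matrix.toLin' P - 1) w = P.mulVec w - w := by simp
      have h2 := ih ((Matrix.toLin' P - 1) w) (by
        rw [h1]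
        simp [mul_sub, h.sum_mul_mulVec, hw0]) (by rw [pow_succ] at hw; exact hw)
      rw [h1, sub_eq_zero] at h2
      exact h.eq_zero_of_mulVec_eq hδ0 hδ hδR hR hw0 h2
  have hle : Module.End.maxGenEigenspace (Matrix.toLin' P) 1 ≤
      Submodule.span ℝ {fun _ : S => (1 : ℝ)} := by
    intro v hv
    rw [Module.End.mem_maxGenEigenspace] at hv
    obtain ⟨m, hm⟩ := hv
    rw [one_smul] at hm
    set c := ∑ x, π x * v x with hc
    have hone : (Matrix.toLin' P - 1) (fun _ : S => (1 : ℝ)) = 0 := by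
      ext x
      simp [Matrix.mulVec, dotProduct, h.row_sum]
    have hw : v - c • (fun _ : S => (1 : ℝ)) = 0 := by
      -- The exponent `m + 1` ensures that constants are killed even if `m = 0`.
      refine hstep (m + 1) _ ?_ ?_
      · simp [mul_sub, ← sum_mul, h.sum_eq_one, ← hc]
      · rw [map_sub, map_smul, pow_succ', Module.End.mul_apply, hm, ← pow_succ', pow_succ,
          Module.End.mul_apply, hone]
        simp
    rw [sub_eq_zero] at hw
    rw [hw]
    exact Submodule.smul_mem _ _ (Submodule.mem_span_singleton_self _)
  exact (Submodule.finrank_mono hle).trans ((finrank_span_le_card _).trans (by simp))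

/-- Stationarity forces a complex eigenvector with `z ≠ 1` to have mean zero, so the contraction
applies to its real and imaginary parts, and the two estimates add up. -/
theorem IsReversible.norm_eigenvalue_le (h : IsReversible P π) (hδ0 : 0 < δ)
    (hδ : ∀ x, δ ≤ P x x) (hδR : δ ≤ R) (hR : PoincareAt P π g R) {z : ℂ} (hz : z ≠ 1)
    (hroot : z ∈ P.charpoly.aroots ℂ) : ‖z‖ ≤ 1 - δ / R := by
  have hR0 : 0 < R := hδ0.trans_le hδR
  have hq : 0 ≤ 1 - δ / R := sub_nonneg.2 ((div_le_one hR0).2 hδR)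
  have h1 : ((P.map (algebraMap ℝ ℂ)).charpoly).eval z = 0 := by
    rw [Matrix.charpoly_map]
    have := (Polynomial.mem_aroots.1 hroot).2
    rwa [Polynomial.aeval_def, ← Polynomial.eval_map] at this
  rw [Matrix.eval_charpoly] at h1
  obtain ⟨v, hv0, hv⟩ := Matrix.exists_mulVec_eq_zero_iff.2 h1
  have hv' : ∀ x, ∑ y, (P x y : ℂ) * v y = z * v x := by
    intro x
    have := congrFun hv x
    rw [Matrix.sub_mulVec, Pi.sub_apply, Pi.zero_apply, sub_eq_zero] at this
    simpa [Matrix.mulVec, dotProduct, Matrix.diagonal_apply] using this.symm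
  set a : S → ℝ := fun x => (v x).re
  set b : S → ℝ := fun x => (v x).im
  have ha : ∀ x, (P.mulVec a) x = (z * v x).re := by
    intro x; rw [← hv']; simp [Matrix.mulVec, dotProduct, a]
  have hb : ∀ x, (P.mulVec b) x = (z * v x).im := by
    intro x; rw [← hv']; simp [Matrix.mulVec, dotProduct, b]
  have hmean : (∑ x, (π x : ℂ) * v x) = 0 := by
    have e : z * ∑ x, (π x : ℂ) * v x = ∑ x, (π x : ℂ) * v x := by
      have hbal : ∀ x y, (π x : ℂ) * P x y = π y * P y x := fun x y => by
        exact_mod_cast h.balance x y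
      have hrow : ∀ x, ∑ y, (P x y : ℂ) = 1 := fun x => by exact_mod_cast h.row_sum x
      rw [mul_sum]
      calc ∑ x, z * (π x * v x) = ∑ x, ∑ y, (π x : ℂ) * P x y * v y := by
            refine sum_congr rfl fun x _ => ?_
            rw [mul_left_comm, ← hv', mul_sum]
            exact sum_congr rfl fun y _ => by ring
        _ = ∑ y, ∑ x, (π x : ℂ) * P x y * v y := sum_comm
        _ = ∑ y, (π y : ℂ) * v y := by
            refine sum_congr rfl fun y _ => ?_
            simp_rw [hbal _ y]
            rw [← sum_mul, ← mul_sum, hrow, mul_one]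
    by_contra hne
    exact hz (mul_right_cancel₀ hne (e.trans (one_mul _).symm))
  have hma : ∑ x, π x * a x = 0 := by
    have := congrArg Complex.re hmean; simpa [a] using this
  have hmb : ∑ x, π x * b x = 0 := by
    have := congrArg Complex.im hmean; simpa [b] using this
  have ia := h.sum_sq_mulVec_le_of_poincare hδ0.le hδ hR0 (hR.le_of_sum_eq_zero h hma)
  have ib := h.sum_sq_mulVec_le_of_poincare hδ0.le hδ hR0 (hR.le_of_sum_eq_zero h hmb)
  have hsum : ‖z‖ ^ 2 * ∑ x, π x * ‖v x‖ ^ 2 ≤ (1 - δ / R) ^ 2 * ∑ x, π x * ‖v x‖ ^ 2 := by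
    have e1 : ‖z‖ ^ 2 * ∑ x, π x * ‖v x‖ ^ 2 =
        ∑ x, π x * (P.mulVec a) x ^ 2 + ∑ x, π x * (P.mulVec b) x ^ 2 := by
      rw [mul_sum, ← sum_add_distrib]
      refine sum_congr rfl fun x _ => ?_
      rw [ha, hb, mul_left_comm, ← mul_pow, ← norm_mul, Complex.sq_norm, Complex.normSq_apply]
      ring
    have e2 : ∑ x, π x * ‖v x‖ ^ 2 = ∑ x, π x * a x ^ 2 + ∑ x, π x * b x ^ 2 := by
      rw [← sum_add_distrib]
      refine sum_congr rfl fun x _ => ?_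
      rw [Complex.sq_norm, Complex.normSq_apply]
      ring
    rw [e1, e2, mul_add]
    exact add_le_add ia ib
  have hpos : 0 < ∑ x, π x * ‖v x‖ ^ 2 := by
    obtain ⟨x, hx⟩ := Function.ne_iff.1 hv0
    refine sum_pos' (fun y _ => mul_nonneg (h.pos y).le (sq_nonneg _)) ⟨x, mem_univ x, ?_⟩
    exact mul_pos (h.pos x) (pow_pos (norm_pos_iff.2 hx) 2)
  exact abs_le_of_sq_le_sq' (le_of_mul_le_mul_right hsum hpos) hq |>.2

theorem IsReversible.le_spectralGap (h : IsReversible P π) (hδ0 : 0 < δ)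
    (hδ : ∀ x, δ ≤ P x x) (hδR : δ ≤ R) (hR : PoincareAt P π g R) :
    δ / R ≤ spectralGap P := by
  have hR0 : 0 < R := hδ0.trans_le hδR
  have hq : 0 ≤ 1 - δ / R := sub_nonneg.2 ((div_le_one hR0).2 hδR)
  have : (((P.charpoly.aroots ℂ).erase 1).map fun z => ‖z‖₊).sup ≤ Real.toNNReal (1 - δ / R) := by
    refine Multiset.sup_le.2 fun b hb => ?_
    obtain ⟨z, hz, rfl⟩ := Multiset.mem_map.1 hb
    have hz1 : z ≠ 1 := by
      rintro rfl
      have h1 : 1 ≤ ((P.charpoly.aroots ℂ).erase 1).count 1 := Multiset.one_le_count_iff_mem.2 hz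
      have h2 : (P.charpoly.aroots ℂ).count 1 = P.charpoly.rootMultiplicity 1 := by
        rw [Polynomial.aroots, Polynomial.count_roots]
        have := Polynomial.eq_rootMultiplicity_map (p := P.charpoly)
          (algebraMap ℝ ℂ).injective 1
        rw [this, map_one]
      rw [Multiset.count_erase_self, h2] at h1
      have h3 := h.rootMultiplicity_le_one hδ0 hδ hδR hR
      omega
    rw [← NNReal.coe_le_coe, Real.coe_toNNReal _ hq]
    exact h.norm_eigenvalue_le hδ0 hδ hδR hR hz1 (Multiset.mem_of_mem_erase hz)
  have h2 : ((((P.charpoly.aroots ℂ).erase 1).map fun z => ‖z‖₊).sup : ℝ) ≤ 1 - δ / R := by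
    rwa [← NNReal.coe_le_coe, Real.coe_toNNReal _ hq] at this
  unfold spectralGap
  linarith

/-- Test the Poincaré inequality on the indicator of the complement of `g`: its Dirichlet form is
the flow out of `g`, at most `π g`. -/
theorem IsReversible.one_le_mul_ground (h : IsReversible P π) (hR0 : 0 ≤ R)
    (hR : PoincareAt P π g R) : 1 ≤ (1 + R) * π g := by
  have h1 := hR (fun x => if x = g then 0 else 1) (by simp)
  have e1 : ∑ x, π x * (if x = g then (0 : ℝ) else 1) ^ 2 = 1 - π g := by
    have : ∀ x, π x * (if x = g then (0 : ℝ) else 1) ^ 2 = π x - if x = g then π x else 0 := by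
      intro x; split_ifs <;> simp
    simp_rw [this]
    rw [sum_sub_distrib, h.sum_eq_one]
    simp
  have e2 : dirichlet P π (fun x => if x = g then 0 else 1) ≤ π g := by
    rw [h.dirichlet_eq, e1]
    have e3 : ∑ x, π x * ((if x = g then (0 : ℝ) else 1) *
        P.mulVec (fun x => if x = g then (0 : ℝ) else 1) x) =
        ∑ x, π x * (P.mulVec (fun x => if x = g then (0 : ℝ) else 1) x) -
          π g * (P.mulVec (fun x => if x = g then (0 : ℝ) else 1) g) := by
      rw [eq_sub_iff_add_eq, ← Finset.sum_erase_add _ _ (mem_univ g)]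
      conv_rhs => rw [← Finset.sum_erase_add _ _ (mem_univ g)]
      simp only [if_true, zero_mul, mul_zero, add_zero]
      congr 1
      exact sum_congr rfl fun x hx => by rw [if_neg (ne_of_mem_erase hx), one_mul]
    have e4 : ∑ x, π x * (if x = g then (0 : ℝ) else 1) = 1 - π g := by
      rw [← e1]
      exact sum_congr rfl fun x _ => by split_ifs <;> simp
    rw [e3, h.sum_mul_mulVec, e4]
    have e5 : P.mulVec (fun x => if x = g then (0 : ℝ) else 1) g ≤ 1 := by
      refine le_of_le_of_eq (sum_le_sum fun y _ => ?_) (h.row_sum g)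
      have := h.nonneg g y
      dsimp only
      split_ifs <;> simp [this]
    nlinarith [h.pos g]
  rw [e1] at h1
  nlinarith

/-- Functions of mean zero decay at `g`. -/
theorem IsReversible.abs_pow_mulVec_ground_le (h : IsReversible P π) (hδ0 : 0 < δ)
    (hδ : ∀ x, δ ≤ P x x) (hδR : δ ≤ R) (hR : PoincareAt P π g R) {f : S → ℝ}
    (hf : ∑ x, π x * f x = 0) {M : ℝ} (hM : 0 ≤ M) (hfM : ∀ x, |f x| ≤ M) (t : ℕ) :
    |(P ^ t).mulVec f g| ≤ M * ((1 + R) * (1 - δ / R) ^ t) := by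
  have hR0 : 0 < R := hδ0.trans_le hδR
  have hq : 0 ≤ 1 - δ / R := sub_nonneg.2 ((div_le_one hR0).2 hδR)
  have h1 := (h.pow_mulVec_sq_le hδ0.le hδ hR0 hR hf t).2
  have h2 : π g * ((P ^ t).mulVec f g) ^ 2 ≤ ∑ x, π x * ((P ^ t).mulVec f) x ^ 2 :=
    single_le_sum (f := fun x => π x * ((P ^ t).mulVec f) x ^ 2)
      (fun x _ => mul_nonneg (h.pos x).le (sq_nonneg _)) (mem_univ g)
  have h3 : ∑ x, π x * f x ^ 2 ≤ M ^ 2 := by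
    calc ∑ x, π x * f x ^ 2 ≤ ∑ x, π x * M ^ 2 := by
          refine sum_le_sum fun x _ => mul_le_mul_of_nonneg_left ?_ (h.pos x).le
          exact sq_le_sq' (abs_le.1 (hfM x)).1 (abs_le.1 (hfM x)).2
      _ = M ^ 2 := by rw [← sum_mul, h.sum_eq_one, one_mul]
  have h4 := h.one_le_mul_ground hR0.le hR
  refine abs_le_of_sq_le_sq ?_ (by positivity)
  set A := (P ^ t).mulVec f g
  have hq2 : 0 ≤ ((1 - δ / R) ^ 2) ^ t := by positivity
  have h5 : π g * A ^ 2 ≤ ((1 - δ / R) ^ 2) ^ t * M ^ 2 :=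
    h2.trans (h1.trans (mul_le_mul_of_nonneg_left h3 hq2))
  -- The lower bound on `π g` turns mean-square decay into decay at the point `g`; no other value of
  -- `π` is needed.
  calc A ^ 2 ≤ ((1 + R) * π g) * A ^ 2 := le_mul_of_one_le_left (sq_nonneg _) h4
    _ = (1 + R) * (π g * A ^ 2) := by ring
    _ ≤ (1 + R) * (((1 - δ / R) ^ 2) ^ t * M ^ 2) := by gcongr
    _ ≤ (1 + R) ^ 2 * (((1 - δ / R) ^ 2) ^ t * M ^ 2) := by
        refine mul_le_mul_of_nonneg_right ?_ (by positivity)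
        nlinarith
    _ = (M * ((1 + R) * (1 - δ / R) ^ t)) ^ 2 := by
        rw [← pow_mul, mul_comm 2 t, pow_mul]; ring

/-- If `u r` bounds the probability of not hitting `g` within `r` steps, and `f` is small at `g`
from time `s` on, then `f` is small everywhere at time `s + r`. -/
theorem IsReversible.abs_pow_mulVec_le (h : IsReversible P π) {f : S → ℝ} {M η : ℝ} (hη : 0 ≤ η)
    (hfM : ∀ x, |f x| ≤ M) {s : ℕ} (hs : ∀ t ≥ s, |(P ^ t).mulVec f g| ≤ M * η)
    {u : ℕ → S → ℝ} (hu0 : ∀ r x, 0 ≤ u r x) (hu1 : ∀ x, x ≠ g → 1 ≤ u 0 x)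
    (hu : ∀ r x, x ≠ g → P.mulVec (u r) x ≤ u (r + 1) x) (r : ℕ) (x : S) :
    |(P ^ (s + r)).mulVec f x| ≤ M * (η + u r x) := by
  have hM : 0 ≤ M := (abs_nonneg _).trans (hfM x)
  have step : ∀ (w b : S → ℝ), (∀ y, |w y| ≤ b y) → ∀ x, |P.mulVec w x| ≤ P.mulVec b x := by
    intro w b hw x
    refine (abs_sum_le_sum_abs _ _).trans (sum_le_sum fun y _ => ?_)
    rw [abs_mul, abs_of_nonneg (h.nonneg x y)]
    exact mul_le_mul_of_nonneg_left (hw y) (h.nonneg x y)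
  have hconst : ∀ c x, P.mulVec (fun _ => c) x = c := by
    intro c x
    simp [Matrix.mulVec, dotProduct, ← sum_mul, h.row_sum]
  have hsucc : ∀ t, (P ^ (t + 1)).mulVec f = P.mulVec ((P ^ t).mulVec f) := fun t => by
    rw [Matrix.mulVec_mulVec, pow_succ']
  have hall : ∀ t x, |(P ^ t).mulVec f x| ≤ M := by
    intro t
    induction t with
    | zero => intro x; simpa using hfM x
    | succ t ih =>
      intro x
      rw [hsucc]
      exact (step _ _ ih x).trans_eq (hconst M x)
  induction r generalizing x with
  | zero =>
    rcases eq_or_ne x g with rfl | hx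
    · refine (hs s le_rfl).trans (mul_le_mul_of_nonneg_left ?_ hM)
      linarith [hu0 0 x]
    · refine (hall s x).trans (le_mul_of_one_le_right hM ?_)
      linarith [hu1 x hx]
  | succ r ih =>
    rcases eq_or_ne x g with rfl | hx
    · refine (hs _ (by omega)).trans (mul_le_mul_of_nonneg_left ?_ hM)
      linarith [hu0 (r + 1) x]
    · rw [← add_assoc, hsucc]
      refine (step _ _ ih x).trans ?_
      have e : P.mulVec (fun y => M * (η + u r y)) x = M * (η + P.mulVec (u r) x) := by
        have : (fun y => M * (η + u r y)) = M • ((fun _ => η) + u r) := by ext; simp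
        rw [this, Matrix.mulVec_smul, Matrix.mulVec_add]
        simp [hconst]
      rw [e]
      gcongr
      exact hu r x hx

/-- Total variation is half of `P ^ (s + r)` applied to the centred sign function, which is bounded
by 2. The `r` steps serve to reach `g`, the `s` steps to relax from there. -/
theorem IsReversible.tvDist_le (h : IsReversible P π) (hδ0 : 0 < δ)
    (hδ : ∀ x, δ ≤ P x x) (hδR : δ ≤ R) (hR : PoincareAt P π g R)
    {u : ℕ → S → ℝ} (hu0 : ∀ r x, 0 ≤ u r x) (hu1 : ∀ x, x ≠ g → 1 ≤ u 0 x)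
    (hu : ∀ r x, x ≠ g → P.mulVec (u r) x ≤ u (r + 1) x) {s r : ℕ} {b : ℝ}
    (hub : ∀ x, u r x ≤ b) :
    tvDist P π (s + r) ≤ (1 + R) * (1 - δ / R) ^ s + b := by
  have hR0 : 0 < R := hδ0.trans_le hδR
  have hq : 0 ≤ 1 - δ / R := sub_nonneg.2 ((div_le_one hR0).2 hδR)
  have hq1 : 1 - δ / R ≤ 1 := by linarith [div_pos hδ0 hR0]
  have : Nonempty S := ⟨g⟩
  refine ciSup_le fun x => ?_
  set σ : S → ℝ := fun y => SignType.sign ((P ^ (s + r)) x y - π y) with hσ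
  have hσ1 : ∀ y, |σ y| ≤ 1 := by
    intro y
    simp only [hσ]
    rcases lt_trichotomy ((P ^ (s + r)) x y - π y) 0 with hh | hh | hh <;>
      simp [hh, sign_neg, sign_pos]
  set c := ∑ y, π y * σ y with hc
  have hc1 : |c| ≤ 1 := by
    rw [← h.sum_eq_one]
    refine (abs_sum_le_sum_abs _ _).trans (sum_le_sum fun y _ => ?_)
    rw [abs_mul, abs_of_pos (h.pos y)]
    exact mul_le_of_le_one_right (h.pos y).le (hσ1 y)
  have hrow : ∀ t x, ∑ y, (P ^ t) x y = 1 := by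
    intro t
    induction t with
    | zero => intro x; simp [Matrix.one_apply]
    | succ t ih =>
      intro x
      rw [pow_succ']
      simp_rw [Matrix.mul_apply]
      rw [sum_comm]
      simp_rw [← mul_sum, ih, mul_one]
      exact h.row_sum x
  have e : ∑ y, |(P ^ (s + r)) x y - π y| = (P ^ (s + r)).mulVec (fun y => σ y - c) x := by
    simp only [Matrix.mulVec, dotProduct, mul_sub, sum_sub_distrib, ← sum_mul, hrow, one_mul]
    rw [hc, ← sum_sub_distrib]
    refine sum_congr rfl fun y _ => ?_
    rw [← sub_mul, hσ]
    exact (self_mul_sign _).symm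
  rw [e]
  have hf0 : ∑ y, π y * (σ y - c) = 0 := by
    simp [mul_sub, ← sum_mul, h.sum_eq_one, ← hc]
  have hf2 : ∀ y, |σ y - c| ≤ 2 := fun y =>
    (abs_sub _ _).trans (by linarith [hσ1 y])
  have hη : 0 ≤ (1 + R) * (1 - δ / R) ^ s := by positivity
  have key := h.abs_pow_mulVec_le (g := g) (s := s) hη hf2 (fun t ht => by
    refine (h.abs_pow_mulVec_ground_le hδ0 hδ hδR hR hf0 (by norm_num) hf2 t).trans ?_
    gcongr 2 * (_ * ?_)
    exact pow_le_pow_of_le_one hq hq1 ht) hu0 hu1 hu r x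
  have := le_abs_self ((P ^ (s + r)).mulVec (fun y => σ y - c) x)
  linarith [hub x]

end Contraction

end Reversible

/-! ### Counting functions that are monotone on classes -/

/-- A finite set of exponent vectors lies in a box, over which the sum factors into truncated
geometric series. -/
theorem sum_prod_pow_le {ι : Type*} [Fintype ι] [DecidableEq ι] (T : Finset (ι → ℕ)) {v : ι → ℝ}
    (hv0 : ∀ l, 0 ≤ v l) (hv1 : ∀ l, v l < 1) :
    ∑ e ∈ T, ∏ l, v l ^ e l ≤ ∏ l, (1 - v l)⁻¹ := by
  have hT : T ⊆ Fintype.piFinset fun l => range (T.sup (fun e => e l) + 1) := by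
    intro e he
    rw [Fintype.mem_piFinset]
    intro l
    exact mem_range.2 (Nat.lt_succ_of_le (le_sup (f := fun e : ι → ℕ => e l) he))
  refine (sum_le_sum_of_subset_of_nonneg hT fun e _ _ =>
    prod_nonneg fun l _ => pow_nonneg (hv0 l) _).trans ?_
  rw [← prod_univ_sum (fun l => range (T.sup (fun e => e l) + 1)) (fun l j => v l ^ j)]
  refine prod_le_prod (fun l _ => sum_nonneg fun j _ => pow_nonneg (hv0 l) j) fun l _ => ?_
  rw [← tsum_geometric_of_lt_one (hv0 l) (hv1 l)]
  exact (summable_geometric_of_lt_one (hv0 l) (hv1 l)).sum_le_tsum _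
    fun j _ => pow_nonneg (hv0 l) j

/-- Each factor is `1 + v l / (1 - v l)`. The product over all places is thus controlled by the sum
of the `v l`, independently of their number. -/
theorem prod_inv_one_sub_le {ι : Type*} [Fintype ι] {v : ι → ℝ} {u : ℝ} (hu : u < 1)
    (hv0 : ∀ l, 0 ≤ v l) (hvu : ∀ l, v l ≤ u) :
    ∏ l, (1 - v l)⁻¹ ≤ Real.exp ((∑ l, v l) / (1 - u)) := by
  rw [sum_div, Real.exp_sum]
  refine prod_le_prod (fun l _ => inv_nonneg.2 (by linarith [hvu l])) fun l _ => ?_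
  have h1 : 0 < 1 - u := by linarith
  have h2 : 0 < 1 - v l := by linarith [hvu l]
  have h3 : (1 - v l)⁻¹ = v l / (1 - v l) + 1 := by field_simp; ring
  rw [h3]
  refine le_trans ?_ (Real.add_one_le_exp _)
  gcongr
  · exact hv0 l
  · exact hvu l

section Gaps

variable {n k : ℕ} (C : Fin n → Fin k)

/-- Increments along a class, unlike the heights themselves, obey no constraint; this is what lets
the count of states factor over the places. -/
theorem exists_gaps {d : Fin n → ℕ} (hd : ∀ l l', C l = C l' → l ≤ l' → d l ≤ d l') :
    ∃ e : Fin n → ℕ, ∀ l, d l = ∑ l' with l' ≤ l ∧ C l' = C l, e l' := by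
  -- By monotonicity the supremum is the value at the preceding label of the class, or 0 if there is
  -- none.
  refine ⟨fun l => d l - ({l' | l' < l ∧ C l' = C l} : Finset (Fin n)).sup d, fun l => ?_⟩
  induction l using WellFoundedLT.induction with
  | ind l ih =>
  have hins : ({l' | l' ≤ l ∧ C l' = C l} : Finset (Fin n)) =
      insert l ({l' | l' < l ∧ C l' = C l} : Finset (Fin n)) := by
    ext l'
    simp only [mem_filter_univ, mem_insert, le_iff_lt_or_eq]
    constructor
    · rintro ⟨h | h, h'⟩
      · exact Or.inr ⟨h, h'⟩
      · exact Or.inl h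
    · rintro (rfl | h)
      · simp
      · exact ⟨Or.inl h.1, h.2⟩
  rw [hins, sum_insert (by simp)]
  rcases ({l' | l' < l ∧ C l' = C l} : Finset (Fin n)).eq_empty_or_nonempty with hs | hs
  · simp [hs]
  set m := ({l' | l' < l ∧ C l' = C l} : Finset (Fin n)).max' hs with hm
  have hmem := max'_mem _ hs
  rw [← hm, mem_filter_univ] at hmem
  have hle : ∀ l' ∈ ({l' | l' < l ∧ C l' = C l} : Finset (Fin n)), l' ≤ m :=
    fun l' hl' => le_max' _ _ hl'
  have hsup : ({l' | l' < l ∧ C l' = C l} : Finset (Fin n)).sup d = d m := by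
    refine le_antisymm (Finset.sup_le fun l' hl' => ?_)
      (le_sup (f := d) (mem_filter_univ m |>.2 hmem))
    exact hd _ _ (by rw [hmem.2, ((mem_filter_univ l').1 hl').2]) (hle l' hl')
  have hset : ({l' | l' < l ∧ C l' = C l} : Finset (Fin n)) =
      ({l' | l' ≤ m ∧ C l' = C m} : Finset (Fin n)) := by
    ext l'
    constructor
    · intro hl'
      have h' := (mem_filter_univ l').1 hl'
      exact (mem_filter_univ l').2 ⟨hle l' hl', by rw [h'.2, hmem.2]⟩
    · intro hl'
      have h' := (mem_filter_univ l').1 hl'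
      exact (mem_filter_univ l').2 ⟨h'.1.trans_lt hmem.1, by rw [h'.2, hmem.2]⟩
  rw [hsup, hset, ← ih m hmem.1]
  have := hd m l hmem.2 hmem.1.le
  omega

/-- The number of `l' < i` in the class of `l` that are at least `l`. -/
def multiplicity (i l : Fin n) : ℕ := #{l' | l ≤ l' ∧ l' < i ∧ C l' = C l}

/-- Within one class the multiplicities of the labels below `i` are distinct, so each of the `k`
classes contributes at most a full geometric series. -/
theorem sum_pow_multiplicity_le {u : ℝ} (hu0 : 0 ≤ u) (hu1 : u < 1) (i : Fin n) :
    ∑ l with l < i, u ^ multiplicity C i l ≤ k / (1 - u) := by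
  rw [← sum_fiberwise _ C]
  have hb : ∀ a ∈ (univ : Finset (Fin k)),
      ∑ l ∈ ({l | l < i} : Finset (Fin n)) with C l = a, u ^ multiplicity C i l ≤
      (1 - u)⁻¹ := by
    intro a _
    have hinj : Set.InjOn (multiplicity C i)
        ({l ∈ ({l | l < i} : Finset (Fin n)) | C l = a} : Finset (Fin n)) := by
      have key : ∀ l l', l < i → C l = a → C l' = a → l < l' →
          multiplicity C i l' < multiplicity C i l := by
        intro l l' hl hCl hCl' hlt
        refine card_lt_card (ssubset_iff_of_subset ?_ |>.2 ⟨l, ?_, ?_⟩)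
        · intro j hj
          simp only [mem_filter_univ] at hj ⊢
          exact ⟨hlt.le.trans hj.1, hj.2.1, by rw [hj.2.2, hCl, hCl']⟩
        · simp [hl]
        · simp [hlt]
      intro l hl l' hl' hll
      simp only [coe_filter, mem_filter, mem_univ, true_and, Set.mem_ofPred_eq] at hl hl'
      rcases lt_trichotomy l l' with h | h | h
      · exact absurd hll (key l l' hl.1 hl.2 hl'.2 h).ne'
      · exact h
      · exact absurd hll (key l' l hl'.1 hl'.2 hl.2 h).ne
    rw [← sum_image (f := fun j => u ^ j) hinj, ← tsum_geometric_of_lt_one hu0 hu1]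
    exact (summable_geometric_of_lt_one hu0 hu1).sum_le_tsum _ fun j _ => pow_nonneg hu0 j
  refine (sum_le_sum hb).trans_eq ?_
  simp [div_eq_mul_inv]

/-- Double counting: the increment at `l` enters every height of its class from `l` up to, but
excluding, `i`. -/
theorem sum_multiplicity_mul {d e : Fin n → ℕ}
    (he : ∀ l, d l = ∑ l' with l' ≤ l ∧ C l' = C l, e l') (i : Fin n) :
    ∑ l with l < i, multiplicity C i l * e l = ∑ l with l < i, d l := by
  simp_rw [he, multiplicity, card_eq_sum_ones, sum_mul, one_mul, sum_filter]
  have : ∀ l : Fin n, (if l < i then ∑ l', if l' ≤ l ∧ C l' = C l then e l' else 0 else 0) =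
      ∑ l', if l < i then if l' ≤ l ∧ C l' = C l then e l' else 0 else 0 := by
    intro l; split_ifs <;> simp
  simp_rw [this]
  rw [sum_comm]
  refine sum_congr rfl fun l _ => ?_
  split_ifs with hl
  · refine sum_congr rfl fun l' _ => ?_
    rw [← ite_and]
    exact if_congr ⟨fun h => ⟨h.2.1, h.1, h.2.2.symm⟩, fun h => ⟨h.2.1, h.1, h.2.2.symm⟩⟩ rfl rfl
  · symm
    refine sum_eq_zero fun l' _ => ?_
    split_ifs with h1 h2
    · exact absurd (h2.1.trans_lt h1) hl
    · rfl
    · rfl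

end Gaps

/-! ### Systems of heights -/

/-- A set `S` whose elements are determined by heights `height x l ≥ 0` that are monotone on each
class of `C` and at most `top`; the height at one place can be lowered or raised by one
whenever this respects the constraints. -/
structure HeightSystem {n k : ℕ} (C : Fin n → Fin k) (S : Type*) where
  height : S → Fin n → ℕ
  top : Fin n → ℕ
  ground : S
  lower : S → Fin n → S
  raise : S → Fin n → S
  top_le : ∀ l, top l ≤ n
  height_injective : Function.Injective height
  height_ground : height ground = 0
  height_le_top : ∀ x l, height x l ≤ top l
  height_mono : ∀ x l l', C l = C l' → l ≤ l' → height x l ≤ height x l'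
  lower_eq_or : ∀ x l, lower x l = x ∨ height x = height (lower x l) + Pi.single l 1
  raise_eq_or : ∀ x l, raise x l = x ∨ height (raise x l) = height x + Pi.single l 1
  height_lower : ∀ x l, 0 < height x l → (∀ l' < l, C l' = C l → height x l' < height x l) →
    height x = height (lower x l) + Pi.single l 1
  height_raise : ∀ x l, height x l < top l →
    (∀ l', l < l' → C l' = C l → height x l < height x l') →
    height (raise x l) = height x + Pi.single l 1

namespace HeightSystem

variable {n k : ℕ} {C : Fin n → Fin k} {S : Type*} (H : HeightSystem C S)

/-- The total height. -/
def total (x : S) : ℕ := ∑ l, H.height x l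

variable {H}

theorem total_eq_add_one {x y : S} {l : Fin n}
    (h : H.height x = H.height y + Pi.single l 1) : H.total x = H.total y + 1 := by
  simp [total, h, sum_add_distrib]

theorem ne_of_height_eq {x y : S} {l : Fin n}
    (h : H.height x = H.height y + Pi.single l 1) : x ≠ y := by
  rintro rfl
  have := total_eq_add_one h
  omega

/-- If two states differ by one at `l`, monotonicity of the lower one supplies the strictness needed
to lower the upper one. With `raise_eq_iff` this makes lowering and raising at the same place
inverse moves. -/
theorem lower_eq_iff {x y : S} (hxy : x ≠ y) {l : Fin n} :
    H.lower x l = y ↔ H.height x = H.height y + Pi.single l 1 := by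
  constructor
  · rintro rfl
    exact (H.lower_eq_or x l).resolve_left hxy.symm
  · intro h
    have hl : H.height x l = H.height y l + 1 := by simp [h]
    have h' := H.height_lower x l (by omega) fun l' hlt hC => by
      have h2 : H.height x l' = H.height y l' := by simp [h, hlt.ne]
      have h3 := H.height_mono y l' l hC hlt.le
      omega
    exact H.height_injective (add_right_cancel (h'.symm.trans h))

theorem raise_eq_iff {x y : S} (hxy : x ≠ y) {l : Fin n} :
    H.raise y l = x ↔ H.height x = H.height y + Pi.single l 1 := by
  constructor
  · rintro rfl
    exact (H.raise_eq_or y l).resolve_left hxy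
  · intro h
    have hl : H.height x l = H.height y l + 1 := by simp [h]
    have h' := H.height_raise y l (by have := H.height_le_top x l; omega) fun l' hlt hC => by
      have h2 : H.height x l' = H.height y l' := by simp [h, hlt.ne']
      have h3 := H.height_mono x l l' hC.symm hlt.le
      omega
    exact H.height_injective (h'.trans h.symm)

theorem eq_ground_iff {x : S} : x = H.ground ↔ H.total x = 0 := by
  constructor
  · rintro rfl
    simp [total, H.height_ground]
  · intro h
    refine H.height_injective ?_
    rw [H.height_ground]
    funext l
    simpa using (sum_eq_zero_iff.1 h) l (mem_univ l)

theorem total_le (x : S) : H.total x ≤ n ^ 2 := by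
  refine (sum_le_sum fun l _ => (H.height_le_top x l).trans (H.top_le l)).trans_eq ?_
  simp [sq]

/-! ### Canonical paths to the ground state -/

variable (H) in
theorem exists_step (x : S) : ∃ y, (x = H.ground → y = H.ground) ∧
    (x ≠ H.ground → ∃ l, (∀ l' < l, H.height x l' = 0) ∧ y = H.lower x l ∧
      H.height x = H.height y + Pi.single l 1) := by
  classical
  by_cases hx : x = H.ground
  · exact ⟨H.ground, fun _ => rfl, fun h => absurd hx h⟩
  have hne : ({l | H.height x l ≠ 0} : Finset (Fin n)).Nonempty := by
    rw [eq_ground_iff, total, sum_eq_zero_iff] at hx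
    push Not at hx
    obtain ⟨l, -, hl⟩ := hx
    exact ⟨l, by simpa using hl⟩
  set l := ({l | H.height x l ≠ 0} : Finset (Fin n)).min' hne with hl
  have h0 : H.height x l ≠ 0 := by
    have := min'_mem _ hne
    rw [← hl] at this
    simpa using this
  have h1 : ∀ l' < l, H.height x l' = 0 := by
    intro l' hl'
    by_contra h
    exact absurd (min'_le _ l' (by simpa using h)) (not_le.2 hl')
  refine ⟨H.lower x l, fun h => absurd h hx, fun _ => ⟨l, h1, rfl, ?_⟩⟩
  exact H.height_lower x l (Nat.pos_of_ne_zero h0) fun l' hl' _ => by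
    rw [h1 l' hl']; exact Nat.pos_of_ne_zero h0

variable (H) in
/-- Lower the first non-zero height. -/
noncomputable def step (x : S) : S := (H.exists_step x).choose

theorem step_ground : H.step H.ground = H.ground :=
  (H.exists_step H.ground).choose_spec.1 rfl

theorem step_spec {x : S} (hx : x ≠ H.ground) : ∃ l, (∀ l' < l, H.height x l' = 0) ∧
    H.step x = H.lower x l ∧ H.height x = H.height (H.step x) + Pi.single l 1 :=
  (H.exists_step x).choose_spec.2 hx

theorem iterate_step_ground (t : ℕ) : H.step^[t] H.ground = H.ground := by
  induction t with
  | zero => rfl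
  | succ t ih => rw [Function.iterate_succ_apply, step_ground, ih]

theorem total_iterate_step {x : S} {t : ℕ} (ht : t ≤ H.total x) :
    H.total (H.step^[t] x) + t = H.total x := by
  induction t with
  | zero => rfl
  | succ t ih =>
    have ih' := ih (by omega)
    rw [Function.iterate_succ_apply']
    have hne : H.step^[t] x ≠ H.ground := by
      rw [Ne, eq_ground_iff]; omega
    obtain ⟨l, -, -, h⟩ := step_spec hne
    have := total_eq_add_one h
    omega

/-- A place is lowered only when all earlier heights are zero. The height at `i` is still positive
at `z`, so no step before `z` has touched a place beyond `i`. -/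
theorem iterate_step_eq {x z : S} (hz : z ≠ H.ground) {i : Fin n} (hi : 0 < H.height z i) {t : ℕ}
    (h : H.step^[t] x = z) :
    (∀ l, i < l → H.height x l = H.height z l) ∧ H.height z i ≤ H.height x i := by
  induction t generalizing x with
  | zero =>
    obtain rfl : x = z := h
    exact ⟨fun _ _ => rfl, le_rfl⟩
  | succ t ih =>
    rw [Function.iterate_succ_apply] at h
    have hx : x ≠ H.ground := by
      rintro rfl
      rw [step_ground, iterate_step_ground] at h
      exact hz h.symm
    obtain ⟨h1, h2⟩ := ih h
    obtain ⟨l, hl, -, he⟩ := step_spec hx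
    have hei : H.height (H.step x) i ≤ H.height x i := by rw [he]; simp
    have hli : l ≤ i := by
      by_contra hlt
      have := hl i (not_le.1 hlt)
      omega
    refine ⟨fun l' hl' => ?_, h2.trans hei⟩
    rw [← h1 l' hl', he]
    simp [(hli.trans_lt hl').ne']

/-- The constant that bounds the weighted number of elements above a given one. -/
noncomputable def loadBound (k : ℕ) (u : ℝ) : ℝ := Real.exp ((k / (1 - u) + 1) / (1 - u))

open Classical in
-- With `i` the first non-zero place of `z`, a state whose path meets `z` is coded by its increments
-- before `i` and its excess over `z` at `i`. The weight is multiplicative in this code.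
theorem sum_descendants_le [Fintype S] {u : ℝ} (hu0 : 0 < u) (hu1 : u < 1) {z : S}
    (hz : z ≠ H.ground) :
    ∑ x with ∃ t ≤ H.total x, H.step^[t] x = z, u ^ (H.total x - H.total z) ≤ loadBound k u := by
  obtain ⟨i, hi0, -, hie⟩ := step_spec hz
  have hi : 0 < H.height z i := by rw [hie]; simp
  choose gap hgap using fun x => exists_gaps C (H.height_mono x)
  -- One unit of increment at `l < i` raises the total height by its multiplicity, one unit of
  -- excess at `i` raises it by one. Places beyond `i` are frozen: their exponent is 0, so the base
  -- 0 there contributes the factor 1.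
  set v : Fin n → ℝ := fun l => if l < i then u ^ multiplicity C i l else if l = i then u else 0
    with hv
  set enc : S → Fin n → ℕ := fun x l =>
    if l < i then gap x l else if l = i then H.height x i - H.height z i else 0 with henc
  set T : Finset S := {x | ∃ t ≤ H.total x, H.step^[t] x = z} with hT
  have hD : ∀ x ∈ T, (∀ l, i < l → H.height x l = H.height z l) ∧
      H.height z i ≤ H.height x i := by
    intro x hx
    obtain ⟨t, -, ht⟩ := (mem_filter_univ x).1 hx
    exact iterate_step_eq hz hi ht
  have hinj : Set.InjOn enc T := by
    intro x hx y hy hxy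
    have hg : ∀ l, l < i → gap x l = gap y l := by
      intro l hl
      have := congrFun hxy l
      simpa [henc, hl] using this
    refine H.height_injective (funext fun l => ?_)
    rcases lt_trichotomy l i with hl | rfl | hl
    · rw [hgap x l, hgap y l]
      refine sum_congr rfl fun l' hl' => hg l' ?_
      exact ((mem_filter_univ l').1 hl').1.trans_lt hl
    · have := congrFun hxy l
      simp only [henc, lt_irrefl, if_false, if_true] at this
      have h1 := (hD x hx).2
      have h2 := (hD y hy).2
      omega
    · rw [(hD x hx).1 l hl, (hD y hy).1 l hl]
  have hterm : ∀ x ∈ T, u ^ (H.total x - H.total z) = ∏ l, v l ^ enc x l := by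
    intro x hx
    have e1 : ∀ l, v l ^ enc x l = u ^ ((if l < i then multiplicity C i l * gap x l else 0) +
        (if l = i then H.height x i - H.height z i else 0)) := by
      intro l
      simp only [hv, henc]
      by_cases h1 : l < i
      · simp [h1, h1.ne, pow_mul]
      · by_cases h2 : l = i <;> simp [h1, h2]
    simp_rw [e1]
    rw [prod_pow_eq_pow_sum, sum_add_distrib, ← sum_filter, sum_multiplicity_mul C (hgap x) i,
      sum_filter]
    congr 1
    have e2 : H.total x = (∑ l, if l < i then H.height x l else 0) +
        (∑ l, if l = i then H.height x i - H.height z i else 0) + H.total z := by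
      rw [total, total, ← sum_add_distrib, ← sum_add_distrib]
      refine sum_congr rfl fun l _ => ?_
      rcases lt_trichotomy l i with hl | rfl | hl
      · simp [hl, hl.ne, hi0 l hl]
      · have := (hD x hx).2
        simp only [lt_irrefl, if_false, if_true]
        omega
      · simp [hl.not_gt, hl.ne', (hD x hx).1 l hl]
    omega
  have hmul : ∀ l, l < i → multiplicity C i l ≠ 0 := by
    intro l hl
    exact card_ne_zero.2 ⟨l, by simp [hl]⟩
  have hv0 : ∀ l, 0 ≤ v l := by
    intro l; simp only [hv]; split_ifs <;> positivity
  have hvu : ∀ l, v l ≤ u := by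
    intro l
    simp only [hv]
    split_ifs with h1 h2
    · exact pow_le_of_le_one hu0.le hu1.le (hmul l h1)
    · exact le_rfl
    · exact hu0.le
  calc ∑ x ∈ T, u ^ (H.total x - H.total z) = ∑ x ∈ T, ∏ l, v l ^ enc x l := sum_congr rfl hterm
    _ = ∑ e ∈ T.image enc, ∏ l, v l ^ e l :=
        (sum_image (f := fun e : Fin n → ℕ => ∏ l, v l ^ e l) hinj).symm
    _ ≤ ∏ l, (1 - v l)⁻¹ := sum_prod_pow_le _ hv0 fun l => (hvu l).trans_lt hu1
    _ ≤ Real.exp ((∑ l, v l) / (1 - u)) := prod_inv_one_sub_le hu1 hv0 hvu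
    _ ≤ loadBound k u := by
      have h1 : ∑ l, v l = ∑ l with l < i, u ^ multiplicity C i l + u := by
        have : ∀ l, v l = (if l < i then u ^ multiplicity C i l else 0) +
            (if l = i then u else 0) := by
          intro l
          simp only [hv]
          by_cases h1 : l < i
          · simp [h1, h1.ne]
          · simp [h1]
        simp_rw [this]
        rw [sum_add_distrib, ← sum_filter]
        simp
      have h2 := sum_pow_multiplicity_le C hu0.le hu1 i
      have h3 : 0 < 1 - u := by linarith
      unfold loadBound
      gcongr
      rw [h1]
      linarith

/-- Weighted Cauchy-Schwarz along the path of `x` to the ground state. -/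
theorem sq_le_sum_path {u : ℝ} (hu0 : 0 < u) (hu1 : u < 1) {f : S → ℝ} (hf : f H.ground = 0)
    (x : S) : f x ^ 2 ≤ (1 - u)⁻¹ * ∑ t ∈ range (H.total x),
      (u ^ t)⁻¹ * (f (H.step^[t] x) - f (H.step (H.step^[t] x))) ^ 2 := by
  have hend : H.step^[H.total x] x = H.ground := by
    have := total_iterate_step (H := H) (x := x) le_rfl
    rw [eq_ground_iff]; omega
  have htel : f x = ∑ t ∈ range (H.total x),
      (f (H.step^[t] x) - f (H.step (H.step^[t] x))) := by
    have := sum_range_sub' (fun t => f (H.step^[t] x)) (H.total x)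
    simp only [Function.iterate_succ_apply', hend, hf, Function.iterate_zero_apply,
      sub_zero] at this
    exact this.symm
  have hcs := sum_sq_le_sum_mul_sum_of_sq_le_mul (range (H.total x))
    (r := fun t => f (H.step^[t] x) - f (H.step (H.step^[t] x))) (f := fun t => u ^ t)
    (g := fun t => (u ^ t)⁻¹ * (f (H.step^[t] x) - f (H.step (H.step^[t] x))) ^ 2)
    (fun t _ => by positivity) (fun t _ => by positivity) (fun t _ => by
      rw [mul_inv_cancel_left₀ (by positivity)])
  rw [← htel] at hcs
  refine hcs.trans (mul_le_mul_of_nonneg_right ?_ (sum_nonneg fun t _ => by positivity))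
  rw [← tsum_geometric_of_lt_one hu0.le hu1]
  exact (summable_geometric_of_lt_one hu0.le hu1).sum_le_tsum _ fun t _ => by positivity

/-- After `t` steps down, `π` has grown by at least `u ^ (-2 * t)`. Half of this cancels the weight
`(u ^ t)⁻¹` from Cauchy-Schwarz; the other half is the weight with which `sum_descendants_le` counts
the paths through an edge once the sums are exchanged. -/
theorem sum_sq_le [Fintype S] {u : ℝ} (hu0 : 0 < u) (hu1 : u < 1) {π : S → ℝ}
    (hπ0 : ∀ x, 0 ≤ π x)
    (hπ : ∀ x y l, H.height x = H.height y + Pi.single l 1 → π x ≤ u ^ 2 * π y)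
    {f : S → ℝ} (hf : f H.ground = 0) :
    ∑ x, π x * f x ^ 2 ≤
      loadBound k u * (1 - u)⁻¹ * ∑ x, π x * (f x - f (H.step x)) ^ 2 := by
  classical
  have hu' : 0 < 1 - u := by linarith
  set G : S → ℝ := fun z => π z * (f z - f (H.step z)) ^ 2 with hG
  have hG0 : ∀ z, 0 ≤ G z := fun z => mul_nonneg (hπ0 z) (sq_nonneg _)
  have hπt : ∀ x t, t ≤ H.total x → π x ≤ (u ^ 2) ^ t * π (H.step^[t] x) := by
    intro x t
    induction t with
    | zero => intro _; simp
    | succ t ih =>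
      intro ht
      refine (ih (by omega)).trans ?_
      have hne : H.step^[t] x ≠ H.ground := by
        have := total_iterate_step (H := H) (x := x) (t := t) (by omega)
        rw [Ne, eq_ground_iff]; omega
      obtain ⟨l, -, -, h⟩ := step_spec hne
      rw [Function.iterate_succ_apply', pow_succ _ t, mul_assoc]
      exact mul_le_mul_of_nonneg_left (hπ _ _ l h) (by positivity)
  have h1 : ∀ x, π x * f x ^ 2 ≤
      (1 - u)⁻¹ * ∑ t ∈ range (H.total x), u ^ t * G (H.step^[t] x) := by
    intro x
    refine (mul_le_mul_of_nonneg_left (sq_le_sum_path hu0 hu1 hf x) (hπ0 x)).trans ?_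
    rw [mul_left_comm, mul_sum]
    refine mul_le_mul_of_nonneg_left (sum_le_sum fun t ht => ?_) (by positivity)
    have h := hπt x t (mem_range.1 ht).le
    have hq : 0 ≤ (u ^ t)⁻¹ * (f (H.step^[t] x) - f (H.step (H.step^[t] x))) ^ 2 := by positivity
    refine (mul_le_mul_of_nonneg_right h hq).trans_eq ?_
    have hut : u ^ t ≠ 0 := by positivity
    simp only [hG]
    rw [← pow_mul, mul_comm 2 t, pow_mul]
    field_simp
  have h2 : ∀ x, ∑ t ∈ range (H.total x), u ^ t * G (H.step^[t] x) ≤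
      ∑ z with z ≠ H.ground,
        if ∃ t ≤ H.total x, H.step^[t] x = z then u ^ (H.total x - H.total z) * G z else 0 := by
    intro x
    have hinj : Set.InjOn (fun t => H.step^[t] x) (range (H.total x)) := by
      intro t ht t' ht' hh
      have e1 := total_iterate_step (H := H) (x := x) (mem_range.1 ht).le
      have e2 := total_iterate_step (H := H) (x := x) (mem_range.1 ht').le
      simp only at hh
      rw [hh] at e1
      omega
    have e : ∑ t ∈ range (H.total x), u ^ t * G (H.step^[t] x) =
        ∑ z ∈ (range (H.total x)).image (fun t => H.step^[t] x),
          u ^ (H.total x - H.total z) * G z := by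
      rw [sum_image hinj]
      refine sum_congr rfl fun t ht => ?_
      have e1 := total_iterate_step (H := H) (x := x) (mem_range.1 ht).le
      congr 2
      omega
    rw [e, ← sum_filter]
    refine sum_le_sum_of_subset_of_nonneg ?_ fun z _ _ => mul_nonneg (by positivity) (hG0 z)
    intro z hz
    obtain ⟨t, ht, rfl⟩ := mem_image.1 hz
    have e1 := total_iterate_step (H := H) (x := x) (mem_range.1 ht).le
    have ht' := mem_range.1 ht
    simp only [mem_filter, mem_univ, true_and]
    exact ⟨by rw [Ne, eq_ground_iff]; omega, t, ht'.le, rfl⟩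
  calc ∑ x, π x * f x ^ 2
      ≤ ∑ x, (1 - u)⁻¹ * ∑ z with z ≠ H.ground,
          if ∃ t ≤ H.total x, H.step^[t] x = z then u ^ (H.total x - H.total z) * G z else 0 :=
        sum_le_sum fun x _ => (h1 x).trans (mul_le_mul_of_nonneg_left (h2 x) (by positivity))
    _ = (1 - u)⁻¹ * ∑ z with z ≠ H.ground, G z *
          ∑ x with ∃ t ≤ H.total x, H.step^[t] x = z, u ^ (H.total x - H.total z) := by
        rw [← mul_sum, sum_comm]
        congr 1
        refine sum_congr rfl fun z _ => ?_
        rw [mul_sum, sum_filter]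
        exact sum_congr rfl fun x _ => by split_ifs <;> ring
    _ ≤ (1 - u)⁻¹ * ∑ z with z ≠ H.ground, G z * loadBound k u := by
        refine mul_le_mul_of_nonneg_left (sum_le_sum fun z hz => ?_) (by positivity)
        exact mul_le_mul_of_nonneg_left
          (sum_descendants_le hu0 hu1 ((mem_filter_univ z).1 hz)) (hG0 z)
    _ ≤ (1 - u)⁻¹ * ∑ z, G z * loadBound k u := by
        refine mul_le_mul_of_nonneg_left (sum_le_sum_of_subset_of_nonneg (filter_subset _ _)
          fun z _ _ => mul_nonneg (hG0 z) (Real.exp_pos _).le) (by positivity)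
    _ = _ := by rw [← sum_mul]; ring

/-! ### Chains on systems of heights -/

section Chain

variable [DecidableEq S]

variable (H) in
/-- Choose a place and a direction uniformly at random; lower the height there, or raise it with
probability `α`. -/
noncomputable def chain (α : S → Fin n → ℝ) : Matrix S S ℝ := fun x y =>
  1 / (2 * (n : ℝ)) * ∑ l, ((if H.lower x l = y then 1 else 0) +
    (α x l * (if H.raise x l = y then 1 else 0) + (1 - α x l) * (if x = y then 1 else 0)))

theorem chain_mulVec [Fintype S] (α : S → Fin n → ℝ) (f : S → ℝ) (x : S) :
    (H.chain α).mulVec f x = 1 / (2 * (n : ℝ)) * ∑ l, (f (H.lower x l) +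
      (α x l * f (H.raise x l) + (1 - α x l) * f x)) := by
  simp only [Matrix.mulVec, dotProduct, chain, mul_assoc, ← mul_sum, sum_mul]
  rw [sum_comm]
  congr 1
  refine sum_congr rfl fun l _ => ?_
  simp [add_mul, sum_add_distrib]

variable {α : S → Fin n → ℝ} {π : S → ℝ}

/-- Balance holds place by place: lowering from `x` to `y` is paired with raising from `y` to `x`.
-/
theorem chain_isReversible [Fintype S] (hn : 0 < n) (hα0 : ∀ x l, 0 ≤ α x l)
    (hα1 : ∀ x l, α x l ≤ 1)
    (hπ0 : ∀ x, 0 < π x) (hπ1 : ∑ x, π x = 1)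
    (hπ : ∀ x y l, H.height x = H.height y + Pi.single l 1 → π x = π y * α y l) :
    IsReversible (H.chain α) π where
  nonneg x y := by
    refine mul_nonneg (by positivity) (sum_nonneg fun l _ => ?_)
    have h1 := hα0 x l
    have h2 := hα1 x l
    refine add_nonneg (by split_ifs <;> norm_num) (add_nonneg ?_ ?_) <;> split_ifs <;> simp [h1, h2]
  row_sum x := by
    have h := chain_mulVec (H := H) α (fun _ => 1) x
    simp only [Matrix.mulVec, dotProduct, mul_one] at h
    rw [h]
    have hn' : (n : ℝ) ≠ 0 := by positivity
    simp
    field_simp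
    norm_num
  pos := hπ0
  sum_eq_one := hπ1
  balance x y := by
    rcases eq_or_ne x y with rfl | hxy
    · rfl
    have key : ∀ x y : S, x ≠ y → ∀ l, π x * (if H.lower x l = y then 1 else 0) =
        π y * (α y l * (if H.raise y l = x then 1 else 0)) := by
      intro x y hxy l
      simp only [lower_eq_iff hxy, raise_eq_iff hxy]
      split_ifs with h
      · rw [hπ x y l h]; ring
      · simp
    simp only [chain, mul_left_comm (π _) (1 / _) _, mul_sum]
    refine sum_congr rfl fun l _ => ?_
    rw [if_neg hxy, if_neg hxy.symm, mul_zero, mul_zero, add_zero, add_zero, mul_add (π x),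
      mul_add (π y), key x y hxy l, key y x hxy.symm l, add_comm]

/-- The upward direction is chosen with probability 1/2 and is then rejected with probability at
least `2 * δ`. -/
theorem le_chain_self (hn : 0 < n) {δ : ℝ} (hα0 : ∀ x l, 0 ≤ α x l) (hα : ∀ x l, α x l ≤ 1 - 2 * δ)
    (x : S) : δ ≤ H.chain α x x := by
  have hn' : (0 : ℝ) < n := by exact_mod_cast hn
  calc δ = 1 / (2 * (n : ℝ)) * ∑ _l : Fin n, 2 * δ := by simp; field_simp
    _ ≤ H.chain α x x := by
      refine mul_le_mul_of_nonneg_left (sum_le_sum fun l _ => ?_) (by positivity)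
      rw [if_pos rfl]
      have h1 := hα0 x l
      have h2 := hα x l
      split_ifs <;> linarith

variable (k) in
/-- The Poincaré constant divided by `n`. -/
noncomputable def relaxation (u : ℝ) : ℝ := 4 * (loadBound k u * (1 - u)⁻¹)

theorem relaxation_ge_one {u : ℝ} (hu0 : 0 < u) (hu1 : u < 1) : 1 ≤ relaxation k u := by
  have h1 : 1 ≤ loadBound k u := by
    refine Real.one_le_exp ?_
    have : 0 < 1 - u := by linarith
    positivity
  have h2 : 1 ≤ (1 - u)⁻¹ := (one_le_inv₀ (by linarith)).2 (by linarith)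
  unfold relaxation
  nlinarith

/-- A canonical step is a single lowering and has probability at least `1 / (2 * n)`; together with
the 1/2 in the Dirichlet form this costs the factor `4 * n`. -/
theorem chain_poincareAt [Fintype S] (hn : 0 < n) {u : ℝ} (hu0 : 0 < u) (hu1 : u < 1)
    (hrev : IsReversible (H.chain α) π) (hα0 : ∀ x l, 0 ≤ α x l) (hα : ∀ x l, α x l ≤ u ^ 2)
    (hπ : ∀ x y l, H.height x = H.height y + Pi.single l 1 → π x = π y * α y l) :
    PoincareAt (H.chain α) π H.ground (relaxation k u * n) := by
  intro f hf
  have hn' : (0 : ℝ) < n := by exact_mod_cast hn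
  have h1 := sum_sq_le (H := H) hu0 hu1 (fun x => (hrev.pos x).le) (fun x y l h => by
    rw [hπ x y l h, mul_comm]
    exact mul_le_mul_of_nonneg_right (hα y l) (hrev.pos y).le) hf
  have h2 : ∑ x, π x * (f x - f (H.step x)) ^ 2 ≤ 4 * n * dirichlet (H.chain α) π f := by
    rw [dirichlet, ← mul_assoc, mul_sum]
    refine sum_le_sum fun x _ => ?_
    have hterm : ∀ y ∈ univ, 0 ≤ π x * H.chain α x y * (f x - f y) ^ 2 := fun y _ =>
      mul_nonneg (mul_nonneg (hrev.pos x).le (hrev.nonneg x y)) (sq_nonneg _)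
    have h3 := single_le_sum hterm (mem_univ (H.step x))
    rcases eq_or_ne x H.ground with rfl | hx
    · rw [step_ground, sub_self]
      have := sum_nonneg hterm
      simp only [ne_eq, OfNat.ofNat_ne_zero, not_false_eq_true, zero_pow, mul_zero]
      positivity
    obtain ⟨l, -, hl, -⟩ := step_spec hx
    have h4 : 1 / (2 * (n : ℝ)) ≤ H.chain α x (H.step x) := by
      have hα1 : ∀ l, α x l ≤ 1 := fun l => (hα x l).trans (by nlinarith)
      have h5 : ∀ l ∈ (univ : Finset (Fin n)), 0 ≤ (if H.lower x l = H.step x then (1 : ℝ) else 0) +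
          (α x l * (if H.raise x l = H.step x then 1 else 0) +
            (1 - α x l) * (if x = H.step x then 1 else 0)) := by
        intro l _
        have h1 := hα0 x l
        have h2 := hα1 l
        refine add_nonneg (by split_ifs <;> norm_num) (add_nonneg ?_ ?_) <;>
          split_ifs <;> simp [h1, h2]
      have h6 := single_le_sum h5 (mem_univ l)
      rw [if_pos hl.symm] at h6
      have h7 : (1 : ℝ) ≤ 1 + (α x l * (if H.raise x l = H.step x then 1 else 0) +
            (1 - α x l) * (if x = H.step x then 1 else 0)) := by
        have h1 := hα0 x l
        have h2 := hα1 l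
        refine le_add_of_nonneg_right (add_nonneg ?_ ?_) <;> split_ifs <;> simp [h1, h2]
      rw [chain]
      exact le_mul_of_one_le_right (by positivity) (h7.trans h6)
    have h5 : π x * (1 / (2 * (n : ℝ))) * (f x - f (H.step x)) ^ 2 ≤
        π x * H.chain α x (H.step x) * (f x - f (H.step x)) ^ 2 := by
      gcongr
      exact (hrev.pos x).le
    calc π x * (f x - f (H.step x)) ^ 2
        = 4 * n * (1 / 2) * (π x * (1 / (2 * (n : ℝ))) * (f x - f (H.step x)) ^ 2) := by
          field_simp
          ring
      _ ≤ _ := mul_le_mul_of_nonneg_left (h5.trans h3) (by positivity)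
  have hc : 0 ≤ loadBound k u * (1 - u)⁻¹ :=
    mul_nonneg (Real.exp_pos _).le (inv_nonneg.2 (by linarith))
  refine h1.trans ((mul_le_mul_of_nonneg_left h2 hc).trans_eq ?_)
  unfold relaxation
  ring

end Chain

end HeightSystem

namespace HeightSystem

variable {n k : ℕ} {C : Fin n → Fin k} {S : Type*} {H : HeightSystem C S}

/-! ### Comparison on monotone functions -/

/-- The order could fail only if the heights at `l` coincide and the upper state alone is lowered.
But then the earlier heights in the class, being smaller still in the lower state, do not block it
either. Hence moving two states by the same place and direction preserves order. -/
theorem height_lower_le_height_lower {x y : S} (hxy : H.height x ≤ H.height y) (l : Fin n) :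
    H.height (H.lower x l) ≤ H.height (H.lower y l) := by
  have hx : H.height (H.lower x l) ≤ H.height x := by
    rcases H.lower_eq_or x l with h | h
    · rw [h]
    · rw [h]; exact le_self_add
  rcases H.lower_eq_or y l with hy | hy
  · rw [hy]; exact hx.trans hxy
  intro l'
  rcases eq_or_ne l' l with rfl | hl'
  · change H.height (H.lower x l') l' ≤ H.height (H.lower y l') l'
    have e1 : H.height y l' = H.height (H.lower y l') l' + 1 := by
      have := congrFun hy l'; simpa using this
    have e2 : H.height x l' ≤ H.height y l' := hxy l'
    rcases eq_or_lt_of_le e2 with e2 | e2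
    · have h1 := H.height_lower x l' (by omega) fun m hm hC => by
        have h2 : H.height y m = H.height (H.lower y l') m := by
          have := congrFun hy m; simpa [hm.ne] using this
        have h3 := H.height_mono (H.lower y l') m l' hC hm.le
        have h4 : H.height x m ≤ H.height y m := hxy m
        omega
      have h2 := congrFun h1 l'
      simp only [Pi.add_apply, Pi.single_eq_same] at h2
      omega
    · have : H.height (H.lower x l') l' ≤ H.height x l' := hx l'
      omega
  · have e1 : H.height y l' = H.height (H.lower y l) l' := by
      have := congrFun hy l'; simpa [hl'] using this
    rw [← e1]
    exact (hx l').trans (hxy l')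

theorem height_le_height_raise (x : S) (l : Fin n) : H.height x ≤ H.height (H.raise x l) := by
  rcases H.raise_eq_or x l with h | h
  · rw [h]
  · rw [h]; exact le_self_add

theorem height_raise_le_height_raise {x y : S} (hxy : H.height x ≤ H.height y) (l : Fin n) :
    H.height (H.raise x l) ≤ H.height (H.raise y l) := by
  have hy := height_le_height_raise (H := H) y l
  rcases H.raise_eq_or x l with hx | hx
  · rw [hx]; exact hxy.trans hy
  intro l'
  rcases eq_or_ne l' l with rfl | hl'
  · change H.height (H.raise x l') l' ≤ H.height (H.raise y l') l'
    have e1 : H.height (H.raise x l') l' = H.height x l' + 1 := by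
      have := congrFun hx l'; simpa using this
    have e2 : H.height x l' ≤ H.height y l' := hxy l'
    rcases eq_or_lt_of_le e2 with e2 | e2
    · have h1 := H.height_raise y l' (by
        have := H.height_le_top (H.raise x l') l'; omega) fun m hm hC => by
        have h2 : H.height (H.raise x l') m = H.height x m := by
          have := congrFun hx m; simpa [hm.ne'] using this
        have h3 := H.height_mono (H.raise x l') l' m hC.symm hm.le
        have h4 : H.height x m ≤ H.height y m := hxy m
        omega
      have h2 := congrFun h1 l'
      simp only [Pi.add_apply, Pi.single_eq_same] at h2
      omega
    · have : H.height y l' ≤ H.height (H.raise y l') l' := hy l'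
      omega
  · have e1 : H.height (H.raise x l) l' = H.height x l' := by
      have := congrFun hx l'; simpa [hl'] using this
    rw [e1]
    exact (hxy l').trans (hy l')

variable [Fintype S] [DecidableEq S]

theorem chain_const_mulVec_mono {c : ℝ} (hc0 : 0 ≤ c) (hc1 : c ≤ 1) {f : S → ℝ}
    (hf : ∀ x y, H.height x ≤ H.height y → f x ≤ f y) {x y : S}
    (hxy : H.height x ≤ H.height y) :
    (H.chain fun _ _ => c).mulVec f x ≤ (H.chain fun _ _ => c).mulVec f y := by
  rw [chain_mulVec, chain_mulVec]
  refine mul_le_mul_of_nonneg_left (sum_le_sum fun l _ => ?_) (by positivity)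
  have h1 := hf _ _ (height_lower_le_height_lower hxy l)
  have h2 := mul_le_mul_of_nonneg_left (hf _ _ (height_raise_le_height_raise hxy l)) hc0
  have h3 := mul_le_mul_of_nonneg_left (hf _ _ hxy) (sub_nonneg.2 hc1)
  linarith

/-- Raising cannot decrease an increasing function, so a larger acceptance probability can only
increase its expectation. -/
theorem chain_mulVec_le {c : ℝ} {α : S → Fin n → ℝ} (hα : ∀ x l, α x l ≤ c) {f : S → ℝ}
    (hf : ∀ x y, H.height x ≤ H.height y → f x ≤ f y) (x : S) :
    (H.chain α).mulVec f x ≤ (H.chain fun _ _ => c).mulVec f x := by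
  rw [chain_mulVec, chain_mulVec]
  refine mul_le_mul_of_nonneg_left (sum_le_sum fun l _ => ?_) (by positivity)
  have h1 := hf _ _ (height_le_height_raise (H := H) x l)
  nlinarith [hα x l]

variable (H) in
/-- The probability that the chain with constant acceptance probability `c` does not visit the
ground state until time `r`. -/
noncomputable def survival (c : ℝ) : ℕ → S → ℝ
  | 0, x => if x = H.ground then 0 else 1
  | r + 1, x => if x = H.ground then 0 else (H.chain fun _ _ => c).mulVec (survival c r) x

theorem survival_ground (c : ℝ) (r : ℕ) : H.survival c r H.ground = 0 := by
  cases r <;> simp [survival]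

theorem survival_nonneg {c : ℝ} (hc0 : 0 ≤ c) (hc1 : c ≤ 1) (r : ℕ) (x : S) :
    0 ≤ H.survival c r x := by
  induction r generalizing x with
  | zero => rw [survival]; split_ifs <;> norm_num
  | succ r ih =>
    rw [survival]
    split_ifs
    · exact le_rfl
    · rw [chain_mulVec]
      refine mul_nonneg (by positivity) (sum_nonneg fun l _ => ?_)
      have h1 := mul_nonneg hc0 (ih (H.raise x l))
      have h2 := mul_nonneg (sub_nonneg.2 hc1) (ih x)
      linarith [ih (H.lower x l)]

theorem survival_mono {c : ℝ} (hc0 : 0 ≤ c) (hc1 : c ≤ 1) (r : ℕ) (x y : S)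
    (hxy : H.height x ≤ H.height y) : H.survival c r x ≤ H.survival c r y := by
  rcases eq_or_ne x H.ground with rfl | hx
  · rw [survival_ground]; exact survival_nonneg hc0 hc1 r y
  have hy : y ≠ H.ground := by
    rintro rfl
    refine hx (H.height_injective ?_)
    rw [H.height_ground] at hxy ⊢
    exact le_antisymm hxy zero_le
  induction r generalizing x y with
  | zero => simp [survival, hx, hy]
  | succ r ih =>
    rw [survival, survival, if_neg hx, if_neg hy]
    refine chain_const_mulVec_mono hc0 hc1 (fun x' y' h' => ?_) hxy
    rcases eq_or_ne x' H.ground with rfl | hx'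
    · rw [survival_ground]; exact survival_nonneg hc0 hc1 r y'
    · refine ih x' y' h' hx' ?_
      rintro rfl
      refine hx' (H.height_injective ?_)
      rw [H.height_ground] at h' ⊢
      exact le_antisymm h' zero_le

/-- The chain with constant acceptance is reversible for weights `u ^ (2 * total)`. The survival
function vanishes at the ground state, so the Poincaré inequality there contracts it in mean square
without any centring. Evaluating at `x` costs the inverse weight of `x`; the normalization is at
most `1 + R` by the bound on the ground mass. -/
theorem survival_le (hn : 0 < n) {u : ℝ} (hu0 : 0 < u) (hu1 : u < 1) (r : ℕ) (x : S) :
    H.survival (u ^ 2) r x ≤ (1 + relaxation k u * n) *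
      (1 - (1 - u ^ 2) / 2 / (relaxation k u * n)) ^ r * (u⁻¹) ^ (n ^ 2) := by
  have hn' : (1 : ℝ) ≤ n := by exact_mod_cast hn
  have hu2 : u ^ 2 < 1 := by nlinarith
  set R := relaxation k u * n with hRdef
  set δ := (1 - u ^ 2) / 2 with hδdef
  have hR1 : 1 ≤ R := one_le_mul_of_one_le_of_one_le (relaxation_ge_one hu0 hu1) hn'
  have hR0 : 0 < R := by linarith
  have hδ0 : 0 < δ := by rw [hδdef]; linarith
  have hδR : δ ≤ R := by rw [hδdef]; nlinarith
  have hq : 0 ≤ 1 - δ / R := sub_nonneg.2 ((div_le_one hR0).2 hδR)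
  set Z := ∑ y, (u ^ 2) ^ H.total y with hZ
  have hZ0 : 0 < Z := sum_pos (fun y _ => by positivity) ⟨x, mem_univ x⟩
  set μ : S → ℝ := fun y => (u ^ 2) ^ H.total y / Z with hμ
  have hbal : ∀ x y l, H.height x = H.height y + Pi.single l 1 → μ x = μ y * u ^ 2 := by
    intro x y l h
    simp only [hμ, total_eq_add_one h, pow_succ _ (H.total y)]
    ring
  have hrev : IsReversible (H.chain fun _ _ => u ^ 2) μ :=
    chain_isReversible hn (fun _ _ => by positivity) (fun _ _ => hu2.le)
      (fun y => by positivity) (by rw [← sum_div]; exact div_self hZ0.ne') hbal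
  have hP := chain_poincareAt hn hu0 hu1 hrev (fun _ _ => by positivity) (fun _ _ => le_rfl) hbal
  have hδ : ∀ x, δ ≤ (H.chain fun _ _ => u ^ 2) x x :=
    le_chain_self hn (fun _ _ => by positivity) (fun _ _ => by rw [hδdef]; linarith)
  have hdecay : ∑ y, μ y * H.survival (u ^ 2) r y ^ 2 ≤ ((1 - δ / R) ^ 2) ^ r := by
    induction r with
    | zero =>
      rw [pow_zero, ← hrev.sum_eq_one]
      refine sum_le_sum fun y _ => mul_le_of_le_one_right (hrev.pos y).le ?_
      rw [survival]; split_ifs <;> norm_num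
    | succ r ih =>
      have h1 : ∑ y, μ y * H.survival (u ^ 2) (r + 1) y ^ 2 ≤
          ∑ y, μ y * (H.chain fun _ _ => u ^ 2).mulVec (H.survival (u ^ 2) r) y ^ 2 := by
        refine sum_le_sum fun y _ => mul_le_mul_of_nonneg_left ?_ (hrev.pos y).le
        rw [survival]
        split_ifs
        · simpa using sq_nonneg _
        · exact le_rfl
      refine h1.trans ((hrev.sum_sq_mulVec_le_of_poincare hδ0.le hδ hR0
        (hP _ (survival_ground _ r))).trans ?_)
      rw [pow_succ' _ r]
      exact mul_le_mul_of_nonneg_left ih (sq_nonneg _)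
  have hx := (single_le_sum (f := fun y => μ y * H.survival (u ^ 2) r y ^ 2)
    (fun y _ => mul_nonneg (hrev.pos y).le (sq_nonneg _)) (mem_univ x)).trans hdecay
  have hg := hrev.one_le_mul_ground hR0.le hP
  have hgZ : Z ≤ 1 + R := by
    have : μ H.ground = 1 / Z := by simp [hμ, eq_ground_iff.1 rfl]
    rw [this, mul_one_div, le_div_iff₀ hZ0] at hg
    linarith
  have hA := survival_nonneg (H := H) (c := u ^ 2) (by positivity) hu2.le r x
  have hmain : H.survival (u ^ 2) r x ≤
      (1 + R) * (1 - δ / R) ^ r * (u⁻¹) ^ H.total x := by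
    refine abs_le_of_sq_le_sq' ?_ (by positivity) |>.2
    have hut : u ^ H.total x ≠ 0 := by positivity
    have e : H.survival (u ^ 2) r x ^ 2 =
        (Z * (u⁻¹ ^ H.total x) ^ 2) * (μ x * H.survival (u ^ 2) r x ^ 2) := by
      simp only [hμ]
      rw [← pow_mul u, mul_comm 2 (H.total x), pow_mul u, inv_pow]
      field_simp
    rw [e]
    calc (Z * (u⁻¹ ^ H.total x) ^ 2) * (μ x * H.survival (u ^ 2) r x ^ 2)
        ≤ ((1 + R) * (u⁻¹ ^ H.total x) ^ 2) * ((1 - δ / R) ^ 2) ^ r :=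
          mul_le_mul (mul_le_mul_of_nonneg_right hgZ (sq_nonneg _)) hx
            (mul_nonneg (hrev.pos x).le (sq_nonneg _)) (by positivity)
      _ ≤ ((1 + R) ^ 2 * (u⁻¹ ^ H.total x) ^ 2) * ((1 - δ / R) ^ 2) ^ r := by
          gcongr
          nlinarith
      _ = _ := by rw [← pow_mul (1 - δ / R) 2 r, mul_comm 2 r, pow_mul]; ring
  refine hmain.trans ?_
  gcongr
  · exact (one_le_inv₀ hu0).2 hu1.le
  · exact total_le x

/-- Spectral gap and convergence of a chain on a system of heights. -/
theorem chain_gap_and_tvDist (hn : 0 < n) {u : ℝ} (hu0 : 0 < u) (hu1 : u < 1)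
    {α : S → Fin n → ℝ} {π : S → ℝ} (hα0 : ∀ x l, 0 ≤ α x l) (hα : ∀ x l, α x l ≤ u ^ 2)
    (hπ0 : ∀ x, 0 < π x) (hπ1 : ∑ x, π x = 1)
    (hπ : ∀ x y l, H.height x = H.height y + Pi.single l 1 → π x = π y * α y l) :
    (1 - u ^ 2) / 2 / (relaxation k u * n) ≤ spectralGap (H.chain α) ∧
    ∀ s r, tvDist (H.chain α) π (s + r) ≤
      (1 + relaxation k u * n) * (1 - (1 - u ^ 2) / 2 / (relaxation k u * n)) ^ s +
      (1 + relaxation k u * n) * (1 - (1 - u ^ 2) / 2 / (relaxation k u * n)) ^ r *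
        (u⁻¹) ^ (n ^ 2) := by
  have hn' : (1 : ℝ) ≤ n := by exact_mod_cast hn
  have hu2 : u ^ 2 < 1 := by nlinarith
  have hR1 : 1 ≤ relaxation k u * n :=
    one_le_mul_of_one_le_of_one_le (relaxation_ge_one hu0 hu1) hn'
  have hδ0 : 0 < (1 - u ^ 2) / 2 := by linarith
  have hδR : (1 - u ^ 2) / 2 ≤ relaxation k u * n := by nlinarith
  have hrev : IsReversible (H.chain α) π :=
    chain_isReversible hn hα0 (fun x l => (hα x l).trans hu2.le) hπ0 hπ1 hπ
  have hP := chain_poincareAt hn hu0 hu1 hrev hα0 hα hπ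
  have hδ : ∀ x, (1 - u ^ 2) / 2 ≤ H.chain α x x :=
    le_chain_self hn hα0 (fun x l => (hα x l).trans (by linarith))
  refine ⟨hrev.le_spectralGap hδ0 hδ hδR hP, fun s r => ?_⟩
  refine hrev.tvDist_le hδ0 hδ hδR hP (u := H.survival (u ^ 2))
    (survival_nonneg (by positivity) hu2.le) (fun x hx => by simp [survival, hx])
    (fun r x hx => ?_) (survival_le hn hu0 hu1 r)
  -- Survival of the dominating chain is increasing in the heights, hence a supersolution for the
  -- actual chain.
  rw [survival, if_neg hx]
  exact chain_mulVec_le hα (survival_mono (by positivity) hu2.le r) x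

end HeightSystem

/-- Elementary estimate for the time after which both error terms are small. -/
theorem exists_time {Λ κ u ε₀ : ℝ} (hΛ : 0 < Λ) (hκ : 0 < κ) (hu0 : 0 < u) (hu1 : u < 1)
    (hε₀ : 0 < ε₀) (hε₁ : ε₀ < 1) : ∃ B : ℝ, 0 < B ∧ ∀ (n : ℕ) (ε : ℝ), 0 < n → κ / n ≤ 1 →
      0 < ε → ε ≤ ε₀ → ∃ T : ℕ, ((2 * T : ℕ) : ℝ) ≤ B * (n : ℝ) ^ 4 * Real.log ε⁻¹ ∧
        ∀ s ≥ T, (1 + Λ * n) * (1 - κ / n) ^ s + (1 + Λ * n) * (1 - κ / n) ^ T * (u⁻¹) ^ (n ^ 2)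
          ≤ ε := by
  set v := Real.log u⁻¹ with hv
  set L₀ := Real.log ε₀⁻¹ with hL₀
  have hv0 : 0 < v := Real.log_pos ((one_lt_inv₀ hu0).2 hu1)
  have hL₀0 : 0 < L₀ := Real.log_pos ((one_lt_inv₀ hε₀).2 hε₁)
  -- Dividing by `L₀ ≤ log ε⁻¹` absorbs the terms without a logarithm into a multiple of `log ε⁻¹`.
  refine ⟨2 * (((Λ + 1 + v) / κ + 1) / L₀ + 1 / κ), by positivity,
    fun n ε hn hκn hε0 hεε => ?_⟩
  have hn' : (1 : ℝ) ≤ n := by exact_mod_cast hn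
  have hn0 : (0 : ℝ) < n := by linarith
  set L := Real.log ε⁻¹ with hL
  have hLL : L₀ ≤ L := Real.log_le_log (by positivity) (by gcongr)
  have hq0 : 0 ≤ 1 - κ / n := by linarith
  have hq1 : 1 - κ / n ≤ 1 := by linarith [div_pos hκ hn0]
  -- The four exponents compensate, in order, the prefactor `1 + Λ * n`, the 2 from the two error
  -- terms, `u⁻¹ ^ (n ^ 2)`, and leave `exp (-L) = ε`.
  set W := Λ * n + 1 + v * n ^ 2 + L with hW
  have hL0 : 0 < L := hL₀0.trans_le hLL
  have hW0 : 0 < W := by positivity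
  refine ⟨⌈n / κ * W⌉₊, ?_, fun s hs => ?_⟩
  · have h1 : ((⌈n / κ * W⌉₊ : ℕ) : ℝ) ≤ n / κ * W + 1 := (Nat.ceil_lt_add_one (by positivity)).le
    have p2 : (n : ℝ) ≤ n ^ 3 := le_self_pow₀ hn' (by norm_num)
    have p3 : (n : ℝ) ^ 2 ≤ n ^ 3 := pow_le_pow_right₀ hn' (by norm_num)
    have p1 : (1 : ℝ) ≤ n ^ 3 := one_le_pow₀ hn'
    have p4 : (1 : ℝ) ≤ n ^ 4 := one_le_pow₀ hn'
    have h2 : W ≤ n ^ 3 * (Λ + 1 + v + L) := by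
      have a1 := mul_le_mul_of_nonneg_left p2 hΛ.le
      have a2 := mul_le_mul_of_nonneg_left p3 hv0.le
      have a3 := mul_le_mul_of_nonneg_left p1 (hL₀0.le.trans hLL)
      rw [hW]; linarith
    have h3 : n / κ * W + 1 ≤ n ^ 4 * ((Λ + 1 + v) / κ + 1 + L / κ) := by
      calc n / κ * W + 1 ≤ n / κ * (n ^ 3 * (Λ + 1 + v + L)) + n ^ 4 := by gcongr
        _ = _ := by field_simp; ring
    have h4 : (Λ + 1 + v) / κ + 1 ≤ ((Λ + 1 + v) / κ + 1) / L₀ * L := by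
      rw [div_mul_eq_mul_div, le_div_iff₀ hL₀0]
      gcongr
    push_cast
    calc 2 * ((⌈n / κ * W⌉₊ : ℕ) : ℝ) ≤ 2 * (n ^ 4 * ((Λ + 1 + v) / κ + 1 + L / κ)) := by linarith
      _ ≤ 2 * (n ^ 4 * (((Λ + 1 + v) / κ + 1) / L₀ * L + L / κ)) := by gcongr
      _ = _ := by ring
  · set T := ⌈n / κ * W⌉₊
    have hT : W ≤ κ / n * T := by
      have := Nat.le_ceil (n / κ * W)
      calc W = κ / n * (n / κ * W) := by field_simp
        _ ≤ _ := by gcongr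
    have h1 : (1 - κ / n) ^ T ≤ Real.exp (-W) := by
      calc (1 - κ / n) ^ T ≤ Real.exp (-(κ / n)) ^ T := by
            gcongr
            linarith [Real.add_one_le_exp (-(κ / n))]
        _ = Real.exp (-(κ / n * T)) := by rw [← Real.exp_nat_mul]; ring_nf
        _ ≤ _ := Real.exp_le_exp.2 (by linarith)
    have h2 : (1 - κ / n) ^ s ≤ (1 - κ / n) ^ T := pow_le_pow_of_le_one hq0 hq1 hs
    have h3 : (u⁻¹) ^ (n ^ 2) = Real.exp (v * n ^ 2) := by
      rw [mul_comm, hv, ← Nat.cast_pow, Real.exp_nat_mul, Real.exp_log (by positivity)]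
    have h4 : (1 : ℝ) ≤ (u⁻¹) ^ (n ^ 2) := one_le_pow₀ ((one_le_inv₀ hu0).2 hu1.le)
    have h5 : 1 + Λ * n ≤ Real.exp (Λ * n) := by linarith [Real.add_one_le_exp (Λ * n)]
    have h6 : (2 : ℝ) ≤ Real.exp 1 := by linarith [Real.add_one_le_exp 1]
    have h7 : Real.exp (-L) = ε := by
      rw [hL, Real.log_inv, neg_neg, Real.exp_log hε0]
    have hT0 : 0 ≤ (1 - κ / n) ^ T := by positivity
    calc (1 + Λ * n) * (1 - κ / n) ^ s + (1 + Λ * n) * (1 - κ / n) ^ T * (u⁻¹) ^ (n ^ 2)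
        ≤ (1 + Λ * n) * ((1 - κ / n) ^ T * (u⁻¹) ^ (n ^ 2)) +
          (1 + Λ * n) * (1 - κ / n) ^ T * (u⁻¹) ^ (n ^ 2) := by
          gcongr
          exact h2.trans (le_mul_of_one_le_right hT0 h4)
      _ = (1 + Λ * n) * 2 * (1 - κ / n) ^ T * (u⁻¹) ^ (n ^ 2) := by ring
      _ ≤ Real.exp (Λ * n) * Real.exp 1 * Real.exp (-W) * Real.exp (v * n ^ 2) := by
          rw [← h3]; gcongr
      _ = ε := by
          rw [← Real.exp_add, ← Real.exp_add, ← Real.exp_add, ← h7, hW]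
          ring_nf

variable {n k : ℕ} {C : Fin n → Fin k}

/-! ### Weights -/

theorem prod_prod_eq_prod_lt {G : Fin n → Fin n → ℝ} (hG : ∀ p, G p p = 1) :
    ∏ p, ∏ r, G p r = ∏ p, ∏ r, if p < r then G p r * G r p else 1 := by
  have e1 : ∀ p r, G p r = (if p < r then G p r else 1) * (if r < p then G p r else 1) := by
    intro p r
    rcases lt_trichotomy p r with h | rfl | h
    · simp [h, h.not_gt]
    · simp [hG]
    · simp [h, h.not_gt]
  have e2 : ∀ p r, (if p < r then G p r * G r p else 1) =
      (if p < r then G p r else 1) * (if p < r then G r p else 1) := by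
    intro p r; split_ifs <;> simp
  simp_rw [e2, prod_mul_distrib]
  conv_lhs => enter [2, p, 2, r]; rw [e1]
  simp_rw [prod_mul_distrib]
  congr 1
  exact prod_comm

theorem weight_eq_prod (q : Fin k → Fin k → ℝ) (x : ParticleSystem C) :
    weight q x = ∏ p, ∏ r, if p < r then q (x.1 p) (x.1 r) else 1 := by
  unfold weight
  refine prod_congr rfl fun p _ => ?_
  rw [← prod_filter]
  refine prod_congr ?_ fun _ _ => rfl
  ext r; simp

/-- The pairs reversed by the swap are `(i, j)`, `(i, m)` and `(m, j)` for `m` strictly between. -/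
theorem prod_inversions_swap {F : Fin n → Fin n → ℝ} {i j : Fin n} (hij : i < j) :
    (∏ p, ∏ r, if p < r ∧ Equiv.swap i j r < Equiv.swap i j p then F p r else 1) =
      F i j * ∏ m ∈ Ioo i j, (F m j * F i m) := by
  have hrow : ∀ p, (∏ r, if p < r ∧ Equiv.swap i j r < Equiv.swap i j p then F p r else 1) =
      (if p = i then F i j * ∏ m ∈ Ioo i j, F i m else 1) *
        (if p ∈ Ioo i j then F p j else 1) := by
    intro p
    rcases eq_or_ne p i with rfl | hpi
    · rw [if_pos rfl, if_neg (by simp), mul_one, ← prod_filter]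
      have : ({r | p < r ∧ Equiv.swap p j r < Equiv.swap p j p} : Finset (Fin n)) =
          insert j (Ioo p j) := by
        ext r
        simp only [mem_filter_univ, mem_insert, mem_Ioo, Equiv.swap_apply_left]
        rcases eq_or_ne r j with rfl | hrj
        · simp [hij]
        · constructor
          · rintro ⟨h1, h2⟩
            rw [Equiv.swap_apply_of_ne_of_ne h1.ne' hrj] at h2
            exact Or.inr ⟨h1, h2⟩
          · rintro (h | ⟨h1, h2⟩)
            · exact absurd h hrj
            · rw [Equiv.swap_apply_of_ne_of_ne h1.ne' hrj]
              exact ⟨h1, h2⟩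
      rw [this, prod_insert (by simp)]
    · rw [if_neg hpi, one_mul]
      by_cases hp : p ∈ Ioo i j
      · rw [if_pos hp]
        rw [mem_Ioo] at hp
        have hpj : p ≠ j := hp.2.ne
        rw [prod_eq_single j]
        · rw [Equiv.swap_apply_of_ne_of_ne hpi hpj, Equiv.swap_apply_right,
            if_pos ⟨hp.2, hp.1⟩]
        · intro r _ hrj
          refine if_neg fun h => ?_
          rw [Equiv.swap_apply_of_ne_of_ne hpi hpj] at h
          rcases eq_or_ne r i with rfl | hri
          · exact absurd h.1 hp.1.not_gt
          · rw [Equiv.swap_apply_of_ne_of_ne hri hrj] at h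
            exact absurd h.1 h.2.not_gt
        · simp
      · rw [if_neg hp]
        rw [mem_Ioo, not_and_or, not_lt, not_lt] at hp
        refine prod_eq_one fun r _ => if_neg fun h => ?_
        obtain ⟨h1, h2⟩ := h
        rcases eq_or_ne p j with rfl | hpj
        · rw [Equiv.swap_apply_right, Equiv.swap_apply_of_ne_of_ne
            (hij.trans h1).ne' h1.ne'] at h2
          exact absurd (hij.trans h1) h2.not_gt
        · rw [Equiv.swap_apply_of_ne_of_ne hpi hpj] at h2
          rcases eq_or_ne r i with rfl | hri
          · rw [Equiv.swap_apply_left] at h2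
            exact absurd (hij.trans h2) h1.not_gt
          rcases eq_or_ne r j with rfl | hrj
          · rw [Equiv.swap_apply_right] at h2
            rcases hp with hp | hp
            · exact absurd h2 hp.not_gt
            · exact absurd h1 hp.not_gt
          · rw [Equiv.swap_apply_of_ne_of_ne hri hrj] at h2
            exact absurd h1 h2.not_gt
  simp_rw [hrow, prod_mul_distrib]
  rw [prod_ite_eq' univ i, if_pos (mem_univ i), ← prod_filter, filter_mem_eq_inter, univ_inter]
  ring

/-- After relabelling positions by the swap, only the inverted pairs change their factor, each by
the ratio `lam`. -/
theorem weight_exchange {q : Fin k → Fin k → ℝ} (hq : ∀ a b, 0 < q a b) (x : ParticleSystem C)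
    {i j : Fin n} (hij : i < j) :
    weight q (exchange x i j) = weight q x * accept q x i j := by
  have e1 : weight q (exchange x i j) = ∏ p, ∏ r,
      if Equiv.swap i j p < Equiv.swap i j r then q (x.1 p) (x.1 r) else 1 := by
    rw [weight_eq_prod]
    rw [← Equiv.prod_comp (Equiv.swap i j)]
    refine prod_congr rfl fun p _ => ?_
    rw [← Equiv.prod_comp (Equiv.swap i j)]
    simp [exchange]
  rw [e1, prod_prod_eq_prod_lt (by simp), accept, ← prod_inversions_swap
    (F := fun p r => lam q (x.1 r) (x.1 p)) hij, weight_eq_prod, ← prod_mul_distrib]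
  refine prod_congr rfl fun p _ => ?_
  rw [← prod_mul_distrib]
  refine prod_congr rfl fun r _ => ?_
  by_cases hpr : p < r
  · have hne : Equiv.swap i j p ≠ Equiv.swap i j r := fun h => hpr.ne ((Equiv.swap i j).injective h)
    rcases lt_or_gt_of_ne hne with h | h
    · simp [hpr, h, h.not_gt]
    · have := (hq (x.1 p) (x.1 r)).ne'
      simp only [hpr, h, h.not_gt, if_true, if_false, one_mul, true_and, lam]
      field_simp
  · simp [hpr]

theorem weight_pos {q : Fin k → Fin k → ℝ} (hq : ∀ a b, 0 < q a b) (x : ParticleSystem C) :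
    0 < weight q x :=
  prod_pos fun _ _ => prod_pos fun _ _ => hq _ _

/-! ### Bias and acceptance probabilities -/

/-- The properties of `q` that the process across smaller classes depends on. -/
structure IsBiased (γ : ℝ) (q : Fin k → Fin k → ℝ) : Prop where
  pos : ∀ a b, 0 < q a b
  lam_le : ∀ a b, a < b → lam q b a ≤ γ⁻¹
  lam_mul_le : ∀ a b c, a < b → b < c → lam q c a * lam q a b ≤ 1

theorem IsBiased.lam_pos {γ : ℝ} {q : Fin k → Fin k → ℝ} (hq : IsBiased γ q) (a b : Fin k) :
    0 < lam q a b := div_pos (hq.pos _ _) (hq.pos _ _)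

theorem IsBiased.accept_nonneg {γ : ℝ} {q : Fin k → Fin k → ℝ} (hq : IsBiased γ q)
    (x : ParticleSystem C) (i j : Fin n) : 0 ≤ accept q x i j :=
  mul_nonneg (hq.lam_pos _ _).le
    (prod_nonneg fun _ _ => mul_nonneg (hq.lam_pos _ _).le (hq.lam_pos _ _).le)

/-- The particles jumped over are of smaller classes than both ends, so each contributes a factor at
most 1 by `lam_mul_le`; the exchanged pair itself contributes `γ⁻¹`. -/
theorem IsBiased.accept_le {γ : ℝ} {q : Fin k → Fin k → ℝ} (hq : IsBiased γ q)
    {x : ParticleSystem C} {i j : Fin n} (hx : x.1 i < x.1 j)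
    (hb : ∀ m, i < m → m < j → x.1 m < x.1 i) : accept q x i j ≤ γ⁻¹ := by
  have h1 : ∏ m ∈ Ioo i j, (lam q (x.1 j) (x.1 m) * lam q (x.1 m) (x.1 i)) ≤ 1 := by
    refine prod_le_one (fun m _ => mul_nonneg (hq.lam_pos _ _).le (hq.lam_pos _ _).le)
      fun m hm => ?_
    rw [mem_Ioo] at hm
    exact hq.lam_mul_le _ _ _ (hb m hm.1 hm.2) hx
  exact (mul_le_of_le_one_right (hq.lam_pos _ _).le h1).trans (hq.lam_le _ _ hx)

/-! ### Largest and smallest elements -/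

theorem largest_spec {s : Finset (Fin n)} {i : Fin n} (hs : s.Nonempty) :
    largest s i ∈ s ∧ ∀ p ∈ s, p ≤ largest s i := by
  rw [largest, dif_pos hs]
  exact ⟨max'_mem _ _, fun p hp => le_max' _ _ hp⟩

theorem smallest_spec {s : Finset (Fin n)} {i : Fin n} (hs : s.Nonempty) :
    smallest s i ∈ s ∧ ∀ p ∈ s, smallest s i ≤ p := by
  rw [smallest, dif_pos hs]
  exact ⟨min'_mem _ _, fun p hp => min'_le _ _ hp⟩

theorem nonempty_of_largest_ne {s : Finset (Fin n)} {i : Fin n} (h : largest s i ≠ i) :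
    s.Nonempty := by
  by_contra hs
  exact h (dif_neg hs)

theorem nonempty_of_smallest_ne {s : Finset (Fin n)} {i : Fin n} (h : smallest s i ≠ i) :
    s.Nonempty := by
  by_contra hs
  exact h (dif_neg hs)

/-! ### Labels of particles -/

/-- The position of the particle with label `l`: the particles are labelled class by class, and
from left to right within a class. -/
def pos (x : ParticleSystem C) : Equiv.Perm (Fin n) := Tuple.sort x.1

theorem apply_pos (hC : Monotone C) (x : ParticleSystem C) (l : Fin n) :
    x.1 (pos x l) = C l := by
  have hcard : ∀ a, Fintype.card {i // C i = a} = Fintype.card {i // x.1 i = a} := by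
    intro a
    rw [Fintype.card_subtype, Fintype.card_subtype, x.2 a]
    rfl
  have he : ∃ σ : Equiv.Perm (Fin n), x.1 ∘ σ = C :=
    ⟨Equiv.ofFiberEquiv fun a => Fintype.equivOfCardEq (hcard a),
      funext fun i => Equiv.ofFiberEquiv_map _ i⟩
  obtain ⟨σ, hσ⟩ := he
  have h := Tuple.comp_sort_eq_comp_iff_monotone.2 (by rwa [hσ] : Monotone (x.1 ∘ σ))
  exact (congrFun h l).symm.trans (congrFun hσ l)

theorem pos_lt_pos (hC : Monotone C) (x : ParticleSystem C) {l l' : Fin n} (hl : l < l')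
    (h : C l = C l') : pos x l < pos x l' := by
  refine (Tuple.eq_sort_iff.1 (rfl : pos x = Tuple.sort x.1)).2 l l' hl ?_
  rw [apply_pos hC, apply_pos hC, h]

theorem lt_of_pos_lt_pos (hC : Monotone C) (x : ParticleSystem C) {l l' : Fin n}
    (hl : pos x l < pos x l') (h : C l = C l') : l < l' := by
  by_contra hle
  rcases eq_or_lt_of_le (not_lt.1 hle) with e | e
  · rw [e] at hl; exact lt_irrefl _ hl
  · exact absurd (pos_lt_pos hC x e h.symm) hl.not_gt

theorem exchange_apply_left (x : ParticleSystem C) (i j : Fin n) :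
    (exchange x i j).1 i = x.1 j := by simp [exchange]

theorem exchange_apply_right (x : ParticleSystem C) (i j : Fin n) :
    (exchange x i j).1 j = x.1 i := by simp [exchange]

theorem exchange_apply_of_ne (x : ParticleSystem C) {i j m : Fin n} (hi : m ≠ i) (hj : m ≠ j) :
    (exchange x i j).1 m = x.1 m := by simp [exchange, Equiv.swap_apply_of_ne_of_ne hi hj]

theorem exchange_comm (x : ParticleSystem C) (i j : Fin n) : exchange x i j = exchange x j i := by
  simp [exchange, Equiv.swap_comm]

theorem exchange_exchange (x : ParticleSystem C) (i j : Fin n) :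
    exchange (exchange x i j) i j = x := by
  simp [exchange]

/-- No particle of either exchanged class lies in between, so the order within every class survives
and the labels travel with the swap. -/
theorem pos_exchange (x : ParticleSystem C) {i j : Fin n} (hij : i < j)
    (hne : x.1 i ≠ x.1 j)
    (hb : ∀ m, i < m → m < j → x.1 m ≠ x.1 i ∧ x.1 m ≠ x.1 j) :
    pos (exchange x i j) = (pos x).trans (Equiv.swap i j) := by
  refine (Tuple.eq_sort_iff.2 ?_).symm
  obtain ⟨h1, h2⟩ := Tuple.eq_sort_iff.1 (rfl : pos x = Tuple.sort x.1)
  have e : ∀ l, (exchange x i j).1 ((pos x).trans (Equiv.swap i j) l) = x.1 (pos x l) := by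
    intro l; simp [exchange]
  refine ⟨fun l l' hl => ?_, fun l l' hl h => ?_⟩
  · simp only [Function.comp_apply, e]
    exact h1 hl
  · rw [e, e] at h
    have hlt := h2 l l' hl h
    simp only [Equiv.trans_apply]
    generalize pos x l = p at *
    generalize pos x l' = r at *
    rcases eq_or_ne p i with rfl | hpi
    · rw [Equiv.swap_apply_left]
      have hrj : r ≠ j := by rintro rfl; exact hne h
      rw [Equiv.swap_apply_of_ne_of_ne hlt.ne' hrj]
      by_contra hle
      exact (hb r hlt (lt_of_le_of_ne (not_lt.1 hle) hrj)).1 h.symm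
    rcases eq_or_ne p j with rfl | hpj
    · have hri : r ≠ i := (hij.trans hlt).ne'
      rw [Equiv.swap_apply_right, Equiv.swap_apply_of_ne_of_ne hri hlt.ne']
      exact hij.trans hlt
    rw [Equiv.swap_apply_of_ne_of_ne hpi hpj]
    rcases eq_or_ne r i with rfl | hri
    · rw [Equiv.swap_apply_left]
      exact hlt.trans hij
    rcases eq_or_ne r j with rfl | hrj
    · rw [Equiv.swap_apply_right]
      by_contra hle
      exact (hb p (lt_of_le_of_ne (not_lt.1 hle) hpi.symm) hlt).2 h
    · rwa [Equiv.swap_apply_of_ne_of_ne hri hrj]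

/-- The number of particles of larger classes to the left of the particle with label `l`. -/
def height (x : ParticleSystem C) (l : Fin n) : ℕ := #{p | p < pos x l ∧ C l < x.1 p}

/-- The particles in between are smaller than both ends, so they see a larger particle at `i` before
and after, and are themselves not counted by either end. Only the particle coming from `j` loses a
larger one on its left. -/
theorem height_exchange (hC : Monotone C) (x : ParticleSystem C) {i j : Fin n} (hij : i < j)
    (hx : x.1 j < x.1 i) (hb : ∀ m, i < m → m < j → x.1 m < x.1 j) :
    height x = height (exchange x i j) + Pi.single ((pos x).symm j) 1 := by
  set y := exchange x i j with hy
  have hpos : ∀ l, pos y l = Equiv.swap i j (pos x l) := by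
    intro l
    rw [hy, pos_exchange x hij hx.ne' fun m h1 h2 => ⟨((hb m h1 h2).trans hx).ne, (hb m h1 h2).ne⟩]
    rfl
  have hyi : y.1 i = x.1 j := exchange_apply_left x i j
  have hyj : y.1 j = x.1 i := exchange_apply_right x i j
  have hym : ∀ m, m ≠ i → m ≠ j → y.1 m = x.1 m := fun m h1 h2 => exchange_apply_of_ne x h1 h2
  funext l
  have hCl : C l = x.1 (pos x l) := (apply_pos hC x l).symm
  rw [Pi.add_apply]
  unfold height
  rw [hpos]
  rcases eq_or_ne (pos x l) j with hl | hlj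
  · have hl' : (pos x).symm j = l := by rw [← hl, Equiv.symm_apply_apply]
    rw [hl', Pi.single_eq_same, hl, Equiv.swap_apply_right]
    rw [hl] at hCl
    rw [hCl]
    have : ({p | p < j ∧ x.1 j < x.1 p} : Finset (Fin n)) =
        insert i ({p | p < i ∧ x.1 j < y.1 p} : Finset (Fin n)) := by
      ext p
      simp only [mem_filter_univ, mem_insert]
      constructor
      · rintro ⟨h1, h2⟩
        rcases lt_trichotomy p i with h | h | h
        · exact Or.inr ⟨h, by rwa [hym p h.ne h1.ne]⟩
        · exact Or.inl h
        · exact absurd h2 (hb p h h1).not_gt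
      · rintro (rfl | ⟨h1, h2⟩)
        · exact ⟨hij, hx⟩
        · rw [hym p h1.ne (h1.trans hij).ne] at h2
          exact ⟨h1.trans hij, h2⟩
    rw [this, card_insert_of_notMem (by simp)]
  · have hl' : l ≠ (pos x).symm j := fun h => hlj (by rw [h, Equiv.apply_symm_apply])
    rw [Pi.single_eq_of_ne hl', add_zero]
    rcases eq_or_ne (pos x l) i with hl | hli
    · rw [hl, Equiv.swap_apply_left]
      rw [hl] at hCl
      rw [hCl]
      congr 1
      ext p
      simp only [mem_filter_univ]
      constructor
      · rintro ⟨h1, h2⟩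
        exact ⟨h1.trans hij, by rwa [hym p h1.ne (h1.trans hij).ne]⟩
      · rintro ⟨h1, h2⟩
        rcases lt_trichotomy p i with h | rfl | h
        · exact ⟨h, by rwa [hym p h.ne h1.ne] at h2⟩
        · rw [hyi] at h2; exact absurd h2 hx.not_gt
        · rw [hym p h.ne' h1.ne] at h2
          exact absurd h2 ((hb p h h1).trans hx).not_gt
    rw [Equiv.swap_apply_of_ne_of_ne hli hlj, hCl]
    generalize pos x l = s at *
    by_cases hs : i < s ∧ s < j
    · congr 1
      ext p
      simp only [mem_filter_univ]
      refine and_congr_right fun hp => ?_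
      have hpj : p ≠ j := (hp.trans hs.2).ne
      rcases eq_or_ne p i with rfl | hpi
      · rw [hyi]
        have := hb s hs.1 hs.2
        exact iff_of_true (this.trans hx) this
      · rw [hym p hpi hpj]
    · refine card_equiv (Equiv.swap i j) fun p => ?_
      simp only [mem_filter_univ]
      rcases eq_or_ne p i with rfl | hpi
      · rw [Equiv.swap_apply_left, hyj]
        refine and_congr_left fun _ => ⟨fun h => ?_, fun h => hij.trans h⟩
        by_contra hle
        exact hs ⟨h, lt_of_le_of_ne (not_lt.1 hle) hlj⟩
      rcases eq_or_ne p j with rfl | hpj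
      · rw [Equiv.swap_apply_right, hyi]
        refine and_congr_left fun _ => ⟨fun h => hij.trans h, fun h => ?_⟩
        by_contra hle
        exact hs ⟨h, lt_of_le_of_ne (not_lt.1 hle) hlj⟩
      · rw [Equiv.swap_apply_of_ne_of_ne hpi hpj, hym p hpi hpj]

/-- Take the label that `x` has at `i`. The words agree before `i`, so in `y` that label sits
strictly to the right of `i`, with the larger particle `y.1 i` as an additional one on its left. -/
theorem height_lt_of_first_difference (hC : Monotone C) {x y : ParticleSystem C} {i : Fin n}
    (hagree : ∀ p < i, x.1 p = y.1 p) (hlt : x.1 i < y.1 i) : height x ≠ height y := by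
  set l := (pos x).symm i with hl
  have hpl : pos x l = i := Equiv.apply_symm_apply _ _
  have hCl : C l = x.1 i := by rw [← apply_pos hC x l, hpl]
  have hy : i < pos y l := by
    by_contra hle
    have hne : pos y l ≠ i := by
      intro h
      have := apply_pos hC y l
      rw [h, hCl] at this
      exact hlt.ne' this
    have hlt' : pos y l < i := lt_of_le_of_ne (not_lt.1 hle) hne
    have h1 : #{p | p < i ∧ x.1 p = C l} ≤ #{l' | l' < l ∧ C l' = C l} := by
      refine (card_le_card ?_).trans
        (card_image_le (s := ({l' | l' < l ∧ C l' = C l} : Finset (Fin n))) (f := pos x))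
      intro p hp
      rw [mem_filter_univ] at hp
      have hCp : C ((pos x).symm p) = C l := by
        rw [← apply_pos hC x, Equiv.apply_symm_apply, hp.2]
      refine mem_image.2 ⟨(pos x).symm p, ?_, Equiv.apply_symm_apply _ _⟩
      rw [mem_filter_univ]
      refine ⟨lt_of_pos_lt_pos hC x ?_ hCp, hCp⟩
      rw [Equiv.apply_symm_apply, hpl]
      exact hp.1
    have h2 : #{l' | l' ≤ l ∧ C l' = C l} ≤ #{p | p < i ∧ x.1 p = C l} := by
      refine card_le_card_of_injOn (pos y) ?_ (pos y).injective.injOn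
      intro l' hl'
      simp only [coe_filter, mem_univ, true_and, Set.mem_ofPred_eq] at hl' ⊢
      have h3 : pos y l' < i := by
        rcases eq_or_lt_of_le hl'.1 with rfl | h
        · exact hlt'
        · exact (pos_lt_pos hC y h hl'.2).trans hlt'
      exact ⟨h3, by rw [hagree _ h3, apply_pos hC, hl'.2]⟩
    have h3 : #{l' | l' < l ∧ C l' = C l} < #{l' | l' ≤ l ∧ C l' = C l} := by
      refine card_lt_card (ssubset_iff_of_subset ?_ |>.2 ⟨l, by simp, by simp⟩)
      intro l' hl'
      rw [mem_filter_univ] at hl' ⊢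
      exact ⟨hl'.1.le, hl'.2⟩
    omega
  intro h
  have h1 : height x l < height y l := by
    unfold height
    rw [hpl]
    refine card_lt_card (ssubset_iff_of_subset ?_ |>.2 ⟨i, ?_, by simp⟩)
    · intro p hp
      rw [mem_filter_univ] at hp ⊢
      exact ⟨hp.1.trans hy, by rw [← hagree p hp.1]; exact hp.2⟩
    · rw [mem_filter_univ, hCl]
      exact ⟨hy, hlt⟩
  rw [h] at h1
  exact lt_irrefl _ h1

theorem height_injective (hC : Monotone C) :
    Function.Injective (height : ParticleSystem C → Fin n → ℕ) := by
  intro x y h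
  by_contra hxy
  have hne : ({p | x.1 p ≠ y.1 p} : Finset (Fin n)).Nonempty := by
    by_contra hem
    rw [not_nonempty_iff_eq_empty, filter_eq_empty_iff] at hem
    exact hxy (Subtype.ext (funext fun p => not_not.1 (hem (mem_univ p))))
  set i := ({p | x.1 p ≠ y.1 p} : Finset (Fin n)).min' hne with hi
  have hi1 : x.1 i ≠ y.1 i := by
    have := min'_mem _ hne
    rw [← hi, mem_filter_univ] at this
    exact this
  have hi2 : ∀ p < i, x.1 p = y.1 p := by
    intro p hp
    by_contra hpp
    exact absurd (min'_le _ p ((mem_filter_univ p).2 hpp)) hp.not_ge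
  rcases lt_or_gt_of_ne hi1 with h' | h'
  · exact height_lt_of_first_difference hC hi2 h' h
  · exact height_lt_of_first_difference hC (fun p hp => (hi2 p hp).symm) h' h.symm

/-- Serves to show that a particle blocked by one of its own class has the same height as its
blocker. -/
theorem height_eq_of_pos_lt (x : ParticleSystem C) {l l' : Fin n} (h : C l = C l')
    (hlt : pos x l < pos x l') (hb : ∀ m, pos x l ≤ m → m < pos x l' → x.1 m ≤ C l) :
    height x l = height x l' := by
  unfold height
  congr 1
  ext p
  rw [mem_filter_univ, mem_filter_univ, h]
  refine and_congr_left fun h2 => ⟨fun h1 => h1.trans hlt, fun h1 => ?_⟩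
  by_contra hle
  have := hb p (not_lt.1 hle) h1
  rw [h] at this
  exact absurd h2 this.not_gt

/-! ### Jumps of labelled particles -/

/-- The nearest particle on the left of `i` that is not of a smaller class. -/
def leftNeighbor (x : ParticleSystem C) (i : Fin n) : Fin n :=
  largest {j | j < i ∧ x.1 i ≤ x.1 j} i

/-- The nearest particle on the right of `i` that is not of a smaller class. -/
def rightNeighbor (x : ParticleSystem C) (i : Fin n) : Fin n :=
  smallest {j | i < j ∧ x.1 i ≤ x.1 j} i

theorem leftNeighbor_spec {x : ParticleSystem C} {i : Fin n}
    (h : ∃ j < i, x.1 i ≤ x.1 j) :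
    leftNeighbor x i < i ∧ x.1 i ≤ x.1 (leftNeighbor x i) ∧
      ∀ m, leftNeighbor x i < m → m < i → x.1 m < x.1 i := by
  have hs : ({j | j < i ∧ x.1 i ≤ x.1 j} : Finset (Fin n)).Nonempty := by
    obtain ⟨j, hj⟩ := h
    exact ⟨j, by simpa using hj⟩
  obtain ⟨h1, h2⟩ := largest_spec (i := i) hs
  rw [mem_filter_univ] at h1
  refine ⟨h1.1, h1.2, fun m hm hmi => ?_⟩
  by_contra hle
  exact absurd (h2 m (by simp [hmi, not_lt.1 hle])) hm.not_ge

theorem rightNeighbor_spec {x : ParticleSystem C} {i : Fin n}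
    (h : ∃ j, i < j ∧ x.1 i ≤ x.1 j) :
    i < rightNeighbor x i ∧ x.1 i ≤ x.1 (rightNeighbor x i) ∧
      ∀ m, i < m → m < rightNeighbor x i → x.1 m < x.1 i := by
  have hs : ({j | i < j ∧ x.1 i ≤ x.1 j} : Finset (Fin n)).Nonempty := by
    obtain ⟨j, hj⟩ := h
    exact ⟨j, by simpa using hj⟩
  obtain ⟨h1, h2⟩ := smallest_spec (i := i) hs
  rw [mem_filter_univ] at h1
  refine ⟨h1.1, h1.2, fun m hm hmi => ?_⟩
  by_contra hle
  exact absurd (h2 m (by simp [hm, not_lt.1 hle])) hmi.not_ge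

theorem exists_of_lt_leftNeighbor {x : ParticleSystem C} {i : Fin n}
    (h : x.1 i < x.1 (leftNeighbor x i)) : ∃ j < i, x.1 i ≤ x.1 j := by
  obtain ⟨j, hj⟩ := nonempty_of_largest_ne (s := {j | j < i ∧ x.1 i ≤ x.1 j}) (i := i)
    fun e => h.ne (congrArg x.1 e).symm
  exact ⟨j, by simpa using hj⟩

theorem exists_of_lt_rightNeighbor {x : ParticleSystem C} {i : Fin n}
    (h : x.1 i < x.1 (rightNeighbor x i)) : ∃ j, i < j ∧ x.1 i ≤ x.1 j := by
  obtain ⟨j, hj⟩ := nonempty_of_smallest_ne (s := {j | i < j ∧ x.1 i ≤ x.1 j}) (i := i)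
    fun e => h.ne (congrArg x.1 e).symm
  exact ⟨j, by simpa using hj⟩

/-- The particle with label `l` jumps to the left if it can. -/
def jumpLeft (x : ParticleSystem C) (l : Fin n) : ParticleSystem C :=
  if x.1 (pos x l) < x.1 (leftNeighbor x (pos x l)) then
    exchange x (pos x l) (leftNeighbor x (pos x l)) else x

/-- The particle with label `l` jumps to the right if it can. -/
def jumpRight (x : ParticleSystem C) (l : Fin n) : ParticleSystem C :=
  if x.1 (pos x l) < x.1 (rightNeighbor x (pos x l)) then
    exchange x (pos x l) (rightNeighbor x (pos x l)) else x

theorem height_jumpLeft (hC : Monotone C) {x : ParticleSystem C} {l : Fin n}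
    (h : x.1 (pos x l) < x.1 (leftNeighbor x (pos x l))) :
    height x = height (jumpLeft x l) + Pi.single l 1 := by
  obtain ⟨h1, h2, h3⟩ := leftNeighbor_spec (exists_of_lt_leftNeighbor h)
  have := height_exchange hC x h1 h h3
  rwa [Equiv.symm_apply_apply, exchange_comm, ← if_pos (c := _ < _) h (t := exchange _ _ _)
    (e := x)] at this

theorem height_jumpRight (hC : Monotone C) {x : ParticleSystem C} {l : Fin n}
    (h : x.1 (pos x l) < x.1 (rightNeighbor x (pos x l))) :
    height (jumpRight x l) = height x + Pi.single l 1 := by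
  obtain ⟨h1, h2, h3⟩ := rightNeighbor_spec (exists_of_lt_rightNeighbor h)
  rw [jumpRight, if_pos h]
  set i := pos x l with hi
  set j := rightNeighbor x i
  -- A right jump is undone by a left jump, so the height formula is applied to the state after the
  -- jump.
  have key := height_exchange hC (exchange x i j) h1
    (by rwa [exchange_apply_left, exchange_apply_right]) (fun m hm hm' => by
      rw [exchange_apply_right, exchange_apply_of_ne x hm.ne' hm'.ne]
      exact h3 m hm hm')
  have hl : (pos (exchange x i j)).symm j = l := by
    rw [Equiv.symm_apply_eq, pos_exchange x h1 h.ne fun m hm hm' =>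
      ⟨(h3 m hm hm').ne, ((h3 m hm hm').trans h).ne⟩]
    simp [← hi]
  rwa [hl, exchange_exchange] at key

theorem card_larger (hC : Monotone C) (x : ParticleSystem C) (a : Fin k) :
    #{p | a < x.1 p} = #{p | a < C p} := by
  symm
  refine card_equiv (pos x) fun p => ?_
  simp [apply_pos hC]

/-- The `k`-particle systems as a system of heights. -/
def particleHeights (hC : Monotone C) : HeightSystem C (ParticleSystem C) where
  height := height
  top l := #{p | C l < C p}
  ground := ⟨C, fun _ => rfl⟩
  lower := jumpLeft
  raise := jumpRight
  top_le l := (card_le_univ _).trans_eq (Fintype.card_fin n)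
  height_injective := height_injective hC
  height_ground := by
    funext l
    have hpos : pos (⟨C, fun _ => rfl⟩ : ParticleSystem C) = Equiv.refl _ :=
      Tuple.sort_eq_refl_iff_monotone.2 hC
    simp only [height, hpos, Pi.zero_apply, card_eq_zero, filter_eq_empty_iff]
    rintro p - ⟨h1, h2⟩
    exact absurd (hC (le_of_lt h1)) h2.not_ge
  height_le_top x l := by
    rw [← card_larger hC x]
    refine card_le_card fun p hp => ?_
    rw [mem_filter_univ] at hp ⊢
    exact hp.2
  height_mono x l l' h hl := by
    rcases eq_or_lt_of_le hl with rfl | hl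
    · exact le_rfl
    refine card_le_card fun p hp => ?_
    rw [mem_filter_univ] at hp ⊢
    exact ⟨hp.1.trans (pos_lt_pos hC x hl h), h ▸ hp.2⟩
  lower_eq_or x l := by
    by_cases h : x.1 (pos x l) < x.1 (leftNeighbor x (pos x l))
    · exact Or.inr (height_jumpLeft hC h)
    · exact Or.inl (if_neg h)
  raise_eq_or x l := by
    by_cases h : x.1 (pos x l) < x.1 (rightNeighbor x (pos x l))
    · exact Or.inr (height_jumpRight hC h)
    · exact Or.inl (if_neg h)
  -- Positive height provides a particle on the left that is not smaller. If the nearest such one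
  -- were of the same class, it would be an earlier label of equal height, against `hlt`.
  height_lower x l hpos hlt := by
    refine height_jumpLeft hC ?_
    have hCl := apply_pos hC x l
    obtain ⟨p, hp⟩ := card_pos.1 hpos
    rw [mem_filter_univ, ← hCl] at hp
    obtain ⟨h1, h2, h3⟩ := leftNeighbor_spec ⟨p, hp.1, hp.2.le⟩
    refine lt_of_le_of_ne h2 fun he => ?_
    set j := leftNeighbor x (pos x l)
    have hj : pos x ((pos x).symm j) = j := Equiv.apply_symm_apply _ _
    have hCj : C ((pos x).symm j) = C l := by rw [← apply_pos hC x, hj, ← he, hCl]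
    have hpl : pos x ((pos x).symm j) < pos x l := by rw [hj]; exact h1
    refine (hlt _ (lt_of_pos_lt_pos hC x hpl hCj) hCj).ne
      (height_eq_of_pos_lt x hCj hpl fun m hm hm' => ?_)
    rw [hj] at hm
    rw [hCj, ← hCl]
    rcases eq_or_lt_of_le hm with rfl | hm
    · exact he.ge
    · exact (h3 m hm hm').le
  -- A height below `top` leaves a larger particle on the right; a blocker of the same class is
  -- again excluded by equal heights.
  height_raise x l htop hlt := by
    refine height_jumpRight hC ?_
    have hCl := apply_pos hC x l
    have hex : ∃ p, pos x l < p ∧ x.1 (pos x l) < x.1 p := by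
      by_contra hno
      push Not at hno
      rw [← card_larger hC x] at htop
      refine htop.not_ge (card_le_card fun p hp => ?_)
      rw [mem_filter_univ] at hp ⊢
      refine ⟨?_, hp⟩
      by_contra hle
      rcases eq_or_lt_of_le (not_lt.1 hle) with rfl | h
      · rw [hCl] at hp; exact lt_irrefl _ hp
      · have := hno p h
        rw [hCl] at this
        exact absurd hp this.not_gt
    obtain ⟨p, hp⟩ := hex
    obtain ⟨h1, h2, h3⟩ := rightNeighbor_spec ⟨p, hp.1, hp.2.le⟩
    refine lt_of_le_of_ne h2 fun he => ?_
    set j := rightNeighbor x (pos x l)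
    have hj : pos x ((pos x).symm j) = j := Equiv.apply_symm_apply _ _
    have hCj : C l = C ((pos x).symm j) := by
      rw [← apply_pos hC x ((pos x).symm j), hj, ← he, hCl]
    have hpl : pos x l < pos x ((pos x).symm j) := by rw [hj]; exact h1
    refine (hlt _ (lt_of_pos_lt_pos hC x hpl hCj) hCj.symm).ne
      (height_eq_of_pos_lt x hCj hpl fun m hm hm' => ?_)
    rw [hj] at hm'
    rw [← hCl]
    rcases eq_or_lt_of_le hm with rfl | hm
    · exact le_rfl
    · exact (h3 m hm hm').le

/-- The probability with which a jump to the right of the particle with label `l` is accepted. -/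
noncomputable def acceptRight (q : Fin k → Fin k → ℝ) (x : ParticleSystem C) (l : Fin n) : ℝ :=
  if x.1 (pos x l) < x.1 (rightNeighbor x (pos x l)) then
    accept q x (pos x l) (rightNeighbor x (pos x l)) else 0

/-- Choosing a position is choosing a label. If no right jump exists, both outcomes are `x`, so the
value 0 of `acceptRight` is harmless there. -/
theorem processSmaller_eq_chain (hC : Monotone C) (q : Fin k → Fin k → ℝ) :
    processSmaller C q = (particleHeights hC).chain (acceptRight q) := by
  ext x y
  unfold processSmaller HeightSystem.chain
  congr 1
  rw [← Equiv.sum_comp (pos x)]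
  refine sum_congr rfl fun l _ => ?_
  change (if x.1 (pos x l) < x.1 (leftNeighbor x (pos x l)) then
      tryExchange x (pos x l) (leftNeighbor x (pos x l)) 1 y else point x y) +
    (if x.1 (pos x l) < x.1 (rightNeighbor x (pos x l)) then
      tryExchange x (pos x l) (rightNeighbor x (pos x l))
        (accept q x (pos x l) (rightNeighbor x (pos x l))) y else point x y) =
    (if jumpLeft x l = y then 1 else 0) + (acceptRight q x l *
      (if jumpRight x l = y then 1 else 0) + (1 - acceptRight q x l) * (if x = y then 1 else 0))
  unfold jumpLeft jumpRight acceptRight tryExchange point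
  congr 1
  · by_cases h : x.1 (pos x l) < x.1 (leftNeighbor x (pos x l)) <;> simp [h]
  · by_cases h : x.1 (pos x l) < x.1 (rightNeighbor x (pos x l)) <;> simp [h]

/-- Spectral gap and convergence of the process across smaller classes. -/
theorem processSmaller_gap_and_tvDist (hn : 0 < n) (hC : Monotone C) {u : ℝ} (hu0 : 0 < u)
    (hu1 : u < 1) {q : Fin k → Fin k → ℝ} (hq : IsBiased (u ^ 2)⁻¹ q) :
    (1 - u ^ 2) / 2 / (HeightSystem.relaxation k u * n) ≤ spectralGap (processSmaller C q) ∧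
    ∀ s r, tvDist (processSmaller C q) (stationary q) (s + r) ≤
      (1 + HeightSystem.relaxation k u * n) *
        (1 - (1 - u ^ 2) / 2 / (HeightSystem.relaxation k u * n)) ^ s +
      (1 + HeightSystem.relaxation k u * n) *
        (1 - (1 - u ^ 2) / 2 / (HeightSystem.relaxation k u * n)) ^ r * (u⁻¹) ^ (n ^ 2) := by
  rw [processSmaller_eq_chain hC]
  have hZ : 0 < ∑ y : ParticleSystem C, weight q y :=
    sum_pos (fun y _ => weight_pos hq.pos y) ⟨(particleHeights hC).ground, mem_univ _⟩
  refine HeightSystem.chain_gap_and_tvDist hn hu0 hu1 (fun x l => ?_) (fun x l => ?_)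
    (fun x => div_pos (weight_pos hq.pos x) hZ) ?_ (fun x y l h => ?_)
  · unfold acceptRight
    split_ifs
    · exact hq.accept_nonneg _ _ _
    · exact le_rfl
  · unfold acceptRight
    split_ifs with h
    · obtain ⟨h1, h2, h3⟩ := rightNeighbor_spec (exists_of_lt_rightNeighbor h)
      have := hq.accept_le h h3
      rwa [inv_inv] at this
    · positivity
  · unfold stationary
    rw [← sum_div]
    exact div_self hZ.ne'
  · have hne := HeightSystem.ne_of_height_eq h
    have hr : jumpRight y l = x := (HeightSystem.raise_eq_iff hne).2 h
    have hlt : y.1 (pos y l) < y.1 (rightNeighbor y (pos y l)) := by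
      by_contra hnot
      rw [jumpRight, if_neg hnot] at hr
      exact hne hr.symm
    obtain ⟨h1, -, -⟩ := rightNeighbor_spec (exists_of_lt_rightNeighbor hlt)
    rw [jumpRight, if_pos hlt] at hr
    rw [acceptRight, if_pos hlt, stationary, stationary, ← hr, weight_exchange hq.pos y h1]
    ring

/-! ### The mirror image -/

/-- Reverse the order of the elements and of the classes. -/
def mirrorClass (C : Fin n → Fin k) : Fin n → Fin k := fun i => (C i.rev).rev

/-- The probabilities between the reversed classes. -/
def mirrorProb (q : Fin k → Fin k → ℝ) : Fin k → Fin k → ℝ := fun a b => q b.rev a.rev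

theorem card_mirror (w : Fin n → Fin k) (a : Fin k) :
    #{i : Fin n | (w i.rev).rev = a} = #{i | w i = a.rev} := by
  refine card_equiv Fin.revPerm fun i => ?_
  simp [Fin.rev_eq_iff]

/-- Reverse the positions and the classes of a `k`-particle system. -/
def mirror (C : Fin n → Fin k) : ParticleSystem C ≃ ParticleSystem (mirrorClass C) where
  toFun x := ⟨fun i => (x.1 i.rev).rev, fun a => by
    rw [card_mirror, x.2, classSize, classSize]
    exact (card_mirror C a).symm⟩
  invFun x := ⟨fun i => (x.1 i.rev).rev, fun a => by
    rw [card_mirror, x.2, classSize, classSize]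
    exact (card_mirror C a.rev).trans (by rw [Fin.rev_rev])⟩
  left_inv x := by simp
  right_inv x := by simp

theorem mirror_apply (x : ParticleSystem C) (i : Fin n) :
    (mirror C x).1 i = (x.1 i.rev).rev := rfl

theorem mirror_exchange (x : ParticleSystem C) (i j : Fin n) :
    mirror C (exchange x i j) = exchange (mirror C x) i.rev j.rev := by
  refine Subtype.ext (funext fun m => ?_)
  simp only [mirror_apply, exchange]
  congr 2
  by_cases h1 : m.rev = i
  · subst h1; simp
  by_cases h2 : m.rev = j
  · subst h2; simp
  rw [Equiv.swap_apply_of_ne_of_ne h1 h2, Equiv.swap_apply_of_ne_of_ne] <;>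
    · rintro rfl
      simp at h1 h2

theorem lam_mirrorProb (q : Fin k → Fin k → ℝ) (a b : Fin k) :
    lam (mirrorProb q) a b = lam q b.rev a.rev := rfl

theorem prod_Ioo_rev (f : Fin n → ℝ) (i j : Fin n) :
    ∏ m ∈ Ioo j.rev i.rev, f m = ∏ m ∈ Ioo i j, f m.rev := by
  refine (prod_equiv Fin.revPerm (fun m => ?_) fun m _ => rfl).symm
  simp [Fin.rev_lt_rev, and_comm]

theorem accept_mirror (q : Fin k → Fin k → ℝ) (x : ParticleSystem C) (i j : Fin n) :
    accept (mirrorProb q) (mirror C x) i.rev j.rev = accept q x j i := by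
  simp only [accept, lam_mirrorProb, mirror_apply, Fin.rev_rev, prod_Ioo_rev]
  congr 1
  exact prod_congr rfl fun m _ => mul_comm _ _

theorem weight_mirror (q : Fin k → Fin k → ℝ) (x : ParticleSystem C) :
    weight (mirrorProb q) (mirror C x) = weight q x := by
  rw [weight_eq_prod, weight_eq_prod, prod_comm, ← Equiv.prod_comp Fin.revPerm]
  refine prod_congr rfl fun p _ => ?_
  rw [← Equiv.prod_comp Fin.revPerm]
  simp [mirror_apply, mirrorProb, Fin.rev_lt_rev]

theorem stationary_mirror (q : Fin k → Fin k → ℝ) (x : ParticleSystem C) :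
    stationary (mirrorProb q) (mirror C x) = stationary q x := by
  rw [stationary, stationary, weight_mirror, ← Equiv.sum_comp (mirror C)]
  simp_rw [weight_mirror]

theorem largest_rev {s t : Finset (Fin n)} (h : ∀ p, p ∈ t ↔ p.rev ∈ s) (i : Fin n) :
    largest t i.rev = (smallest s i).rev := by
  by_cases hs : s.Nonempty
  · have ht : t.Nonempty := by
      obtain ⟨p, hp⟩ := hs
      exact ⟨p.rev, by rwa [h, Fin.rev_rev]⟩
    obtain ⟨h1, h2⟩ := largest_spec (i := i.rev) ht
    obtain ⟨h3, h4⟩ := smallest_spec (i := i) hs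
    refine le_antisymm ?_ (h2 _ (by rwa [h, Fin.rev_rev]))
    rw [Fin.le_rev_iff]
    exact h4 _ ((h _).1 h1)
  · have ht : ¬ t.Nonempty := by
      rintro ⟨p, hp⟩
      exact hs ⟨p.rev, (h p).1 hp⟩
    rw [largest, smallest, dif_neg hs, dif_neg ht]

theorem smallest_rev {s t : Finset (Fin n)} (h : ∀ p, p ∈ t ↔ p.rev ∈ s) (i : Fin n) :
    smallest t i.rev = (largest s i).rev := by
  have := largest_rev (s := t) (t := s) (fun p => by rw [h, Fin.rev_rev]) i.rev
  rw [Fin.rev_rev] at this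
  rw [this, Fin.rev_rev]

/-- Reversal exchanges left with right and smaller with larger classes, so each move matches the
opposite move at the reversed position. -/
theorem processLarger_eq_submatrix (C : Fin n → Fin k) (q : Fin k → Fin k → ℝ) :
    processLarger C q =
      (processSmaller (mirrorClass C) (mirrorProb q)).submatrix (mirror C) (mirror C) := by
  ext x y
  rw [Matrix.submatrix_apply, processLarger, processSmaller]
  congr 1
  refine Eq.trans ?_ (Equiv.sum_comp Fin.revPerm _)
  refine sum_congr rfl fun i _ => ?_
  have hpoint : ∀ z : ParticleSystem C, point (mirror C z) (mirror C y) = point z y := by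
    intro z; simp [point]
  have htry : ∀ j a, tryExchange (mirror C x) i.rev j.rev a (mirror C y) =
      tryExchange x i j a y := by
    intro j a
    rw [tryExchange, tryExchange, ← mirror_exchange, hpoint, hpoint]
  have h1 : largest {j | j < i.rev ∧ (mirror C x).1 i.rev ≤ (mirror C x).1 j} i.rev =
      (smallest {j | i < j ∧ x.1 j ≤ x.1 i} i).rev := by
    refine largest_rev (fun p => ?_) i
    simp [mirror_apply, Fin.lt_rev_iff]
  have h2 : smallest {j | i.rev < j ∧ (mirror C x).1 i.rev ≤ (mirror C x).1 j} i.rev =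
      (largest {j | j < i ∧ x.1 j ≤ x.1 i} i).rev := by
    refine smallest_rev (fun p => ?_) i
    simp [mirror_apply, Fin.rev_lt_iff]
  simp only [Fin.revPerm_apply, h1, h2, htry, accept_mirror, hpoint]
  simp only [mirror_apply, Fin.rev_rev, Fin.rev_lt_rev]

/-! ### Invariance under renaming of states -/

section Submatrix

variable {S S' : Type*} [Fintype S] [DecidableEq S] [Fintype S'] [DecidableEq S']

theorem spectralGap_submatrix (e : S ≃ S') (P : Matrix S' S' ℝ) :
    spectralGap (P.submatrix e e) = spectralGap P := by
  have := Matrix.charpoly_reindex e.symm P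
  rw [Matrix.reindex_apply, Equiv.symm_symm] at this
  rw [spectralGap, this, spectralGap]

theorem tvDist_submatrix (e : S ≃ S') (P : Matrix S' S' ℝ) (π : S' → ℝ) (t : ℕ) :
    tvDist (P.submatrix e e) (fun x => π (e x)) t = tvDist P π t := by
  have hpow : (P.submatrix e e) ^ t = (P ^ t).submatrix e e := by
    induction t with
    | zero => simp
    | succ t ih => rw [pow_succ, ih, pow_succ, Matrix.submatrix_mul_equiv]
  rw [tvDist, tvDist, hpow, ← e.iSup_comp]
  congr 1
  funext x
  rw [← Equiv.sum_comp e]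
  rfl

end Submatrix

/-! ### Bias of weakly monotonic bounded classes -/

section Bias

variable {p : Fin n → Fin n → ℝ} {q : Fin k → Fin k → ℝ} {γ : ℝ}

theorem MonotoneRight.le (h : MonotoneRight p) {i j j' : Fin n} (hij : i < j) (hj : j ≤ j') :
    p i j ≤ p i j' := by
  obtain ⟨d, hd⟩ := Nat.exists_eq_add_of_le (Fin.le_def.1 hj)
  induction d generalizing j' with
  | zero => rw [Fin.ext (hd.trans (add_zero _))]
  | succ d ih =>
    have hlt : (j : ℕ) + d < n := by have := j'.2; omega
    exact (ih (j' := ⟨j + d, hlt⟩) (Fin.le_def.2 (Nat.le_add_right _ _)) rfl).trans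
      (h i _ j' (hij.trans_le (Fin.le_def.2 (Nat.le_add_right _ _))) hd)

theorem MonotoneLeft.le (h : MonotoneLeft p) {i i' j : Fin n} (hij : i < j) (hi : i' ≤ i) :
    p i j ≤ p i' j := by
  obtain ⟨d, hd⟩ := Nat.exists_eq_add_of_le (Fin.le_def.1 hi)
  induction d generalizing i' with
  | zero => rw [Fin.ext (hd.trans (add_zero _))]
  | succ d ih =>
    have hlt : (i' : ℕ) + 1 < n := by have := i.2; omega
    have hle : (⟨i' + 1, hlt⟩ : Fin n) ≤ i := Fin.le_def.2 (by simp only; omega)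
    exact (ih (i' := ⟨i' + 1, hlt⟩) hle (by simp only; omega)).trans
      (h _ i' j (hle.trans_lt hij) rfl)

theorem bias_of_lt (hp : IsProbSet p) (hpos : PositivelyBiased p) (hK : IsKClass p C q)
    (hB : BoundedBy γ p C) (hγ : 1 < γ) {a b : Fin k} (hab : a < b) :
    0 < q a b ∧ 0 < q b a ∧ q b a = 1 - q a b ∧ lam q b a ≤ γ⁻¹ := by
  obtain ⟨x, rfl⟩ := hK.surj a
  obtain ⟨y, rfl⟩ := hK.surj b
  have hxy : x < y := hK.mono.reflect_lt hab
  rw [← hK.eq x y hxy.ne, ← hK.eq y x hxy.ne', lam, ← hK.eq x y hxy.ne, ← hK.eq y x hxy.ne']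
  have h1 : 0 < p x y := by linarith [hpos x y hxy]
  have h2 := hB x y hxy hab.ne
  have h3 : 0 < p y x := by
    refine lt_of_le_of_ne (hp.nonneg y x hxy.ne') fun h => ?_
    -- A vanishing denominator would make the quotient 0, which is below `γ`.
    rw [← h, div_zero] at h2
    linarith
  refine ⟨h1, h3, hp.symm x y hxy.ne, ?_⟩
  rw [← inv_div]
  exact inv_anti₀ (by linarith) h2

theorem q_pos (hp : IsProbSet p) (hpos : PositivelyBiased p) (hK : IsKClass p C q)
    (hB : BoundedBy γ p C) (hγ : 1 < γ) (a b : Fin k) : 0 < q a b := by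
  rcases lt_trichotomy a b with h | rfl | h
  · exact (bias_of_lt hp hpos hK hB hγ h).1
  · rw [hK.half]; norm_num
  · exact (bias_of_lt hp hpos hK hB hγ h).2.1

theorem div_mul_div_le_one {a b c d : ℝ} (hb : 0 < b) (hc : 0 ≤ c) (hd : 0 < d)
    (hcb : c ≤ b) (had : a ≤ d) : a / b * (c / d) ≤ 1 := by
  rw [div_mul_div_comm, div_le_one (by positivity)]
  nlinarith

/-- For `a < b < c` monotonicity gives `q a b ≤ q a c`, and by taking complements `q c a ≤ q b a`;
the product of the two ratios is then at most 1. -/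
theorem isBiased_of_monotoneRight (hp : IsProbSet p) (hpos : PositivelyBiased p)
    (hK : IsKClass p C q) (hB : BoundedBy γ p C) (hγ : 1 < γ) (hR : MonotoneRight p) :
    IsBiased γ q where
  pos := q_pos hp hpos hK hB hγ
  lam_le a b hab := (bias_of_lt hp hpos hK hB hγ hab).2.2.2
  lam_mul_le a b c hab hbc := by
    have h1 := bias_of_lt hp hpos hK hB hγ hab
    have h2 := bias_of_lt hp hpos hK hB hγ (hab.trans hbc)
    have h3 : q a b ≤ q a c := by
      obtain ⟨x, rfl⟩ := hK.surj a
      obtain ⟨y, rfl⟩ := hK.surj b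
      obtain ⟨z, rfl⟩ := hK.surj c
      have hxy : x < y := hK.mono.reflect_lt hab
      have hyz : y < z := hK.mono.reflect_lt hbc
      rw [← hK.eq x y hxy.ne, ← hK.eq x z (hxy.trans hyz).ne]
      exact hR.le hxy hyz.le
    exact div_mul_div_le_one h2.1 h1.1.le h1.2.1 h3 (by rw [h2.2.2.1, h1.2.2.1]; linarith)

/-- Reversal turns monotonicity in the first index into the inequality that monotonicity in the
second index gives directly. -/
theorem isBiased_mirror_of_monotoneLeft (hp : IsProbSet p) (hpos : PositivelyBiased p)
    (hK : IsKClass p C q) (hB : BoundedBy γ p C) (hγ : 1 < γ) (hL : MonotoneLeft p) :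
    IsBiased γ (mirrorProb q) where
  pos a b := q_pos hp hpos hK hB hγ _ _
  lam_le a b hab := (bias_of_lt hp hpos hK hB hγ (Fin.rev_lt_rev.2 hab)).2.2.2
  lam_mul_le a b c hab hbc := by
    rw [lam_mirrorProb, lam_mirrorProb]
    have hab' := Fin.rev_lt_rev.2 hab
    have hbc' := Fin.rev_lt_rev.2 hbc
    generalize a.rev = a at *
    generalize b.rev = b at *
    generalize c.rev = c at *
    have h1 := bias_of_lt hp hpos hK hB hγ hab'
    have h2 := bias_of_lt hp hpos hK hB hγ (hbc'.trans hab')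
    have h3 : q b a ≤ q c a := by
      obtain ⟨x, rfl⟩ := hK.surj a
      obtain ⟨y, rfl⟩ := hK.surj b
      obtain ⟨z, rfl⟩ := hK.surj c
      have hyx : y < x := hK.mono.reflect_lt hab'
      have hzy : z < y := hK.mono.reflect_lt hbc'
      rw [← hK.eq y x hyx.ne, ← hK.eq z x (hzy.trans hyx).ne]
      exact hL.le hyx hzy.le
    exact div_mul_div_le_one h2.1 h1.1.le h1.2.1 h3 (by rw [h2.2.2.1, h1.2.2.1]; linarith)

/-- Spectral gap and convergence of both `k`-particle processes. -/
theorem particleProcess_gap_and_tvDist (hn : 0 < n) (hp : IsProbSet p) (hw : WeaklyMonotonic p)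
    (hK : IsKClass p C q) {u : ℝ} (hu0 : 0 < u) (hu1 : u < 1) (hB : BoundedBy (u ^ 2)⁻¹ p C)
    {P : Matrix (ParticleSystem C) (ParticleSystem C) ℝ} (hP : IsParticleProcess p C q P) :
    (1 - u ^ 2) / 2 / (HeightSystem.relaxation k u * n) ≤ spectralGap P ∧
    ∀ s r, tvDist P (stationary q) (s + r) ≤
      (1 + HeightSystem.relaxation k u * n) *
        (1 - (1 - u ^ 2) / 2 / (HeightSystem.relaxation k u * n)) ^ s +
      (1 + HeightSystem.relaxation k u * n) *
        (1 - (1 - u ^ 2) / 2 / (HeightSystem.relaxation k u * n)) ^ r * (u⁻¹) ^ (n ^ 2) := by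
  have hγ : 1 < (u ^ 2)⁻¹ := (one_lt_inv₀ (by positivity)).2 (by nlinarith)
  rcases hP with ⟨hR, rfl⟩ | ⟨hL, rfl⟩
  · exact processSmaller_gap_and_tvDist hn hK.mono hu0 hu1
      (isBiased_of_monotoneRight hp hw.1 hK hB hγ hR)
  · have hC : Monotone (mirrorClass C) := fun i j hij =>
      Fin.rev_le_rev.2 (hK.mono (Fin.rev_le_rev.2 hij))
    obtain ⟨h1, h2⟩ := processSmaller_gap_and_tvDist hn hC hu0 hu1
      (isBiased_mirror_of_monotoneLeft hp hw.1 hK hB hγ hL)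
    rw [processLarger_eq_submatrix, spectralGap_submatrix]
    refine ⟨h1, fun s r => ?_⟩
    have : stationary q = fun x : ParticleSystem C => stationary (mirrorProb q) (mirror C x) :=
      funext fun x => (stationary_mirror q x).symm
    rw [this, tvDist_submatrix]
    exact h2 s r

end Bias

/-! ### The theorem and its constants -/

theorem IsKClass.pos_of_pos {p : Fin n → Fin n → ℝ} {q : Fin k → Fin k → ℝ} (hK : IsKClass p C q)
    (hk : 0 < k) : 0 < n := by
  obtain ⟨i, -⟩ := hK.surj ⟨0, hk⟩
  exact i.pos

end KParticle

theorem mainTheorem5 (k : ℕ) (hk : 2 ≤ k) (γ : ℝ) (hγ : 1 < γ) :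
    (∃ A : ℝ, 0 < A ∧
      ∀ (n : ℕ) (p : Fin n → Fin n → ℝ) (C : Fin n → Fin k) (q : Fin k → Fin k → ℝ)
        (P : Matrix (KParticle.ParticleSystem C) (KParticle.ParticleSystem C) ℝ),
        KParticle.IsProbSet p → KParticle.WeaklyMonotonic p → KParticle.IsKClass p C q →
        KParticle.BoundedBy γ p C → KParticle.IsParticleProcess p C q P →
        A * ((n : ℝ) ^ (k - 1) *
            ∏ i ∈ Finset.univ.filter (fun i : Fin k => (i : ℕ) + 1 < k),
              ((KParticle.classSize C i : ℝ) + Real.log n))⁻¹ ≤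
          KParticle.spectralGap P) ∧
    (∀ ε₀ : ℝ, 0 < ε₀ → ε₀ < 1 → ∃ B : ℝ, 0 < B ∧
      ∀ (n : ℕ) (p : Fin n → Fin n → ℝ) (C : Fin n → Fin k) (q : Fin k → Fin k → ℝ)
        (P : Matrix (KParticle.ParticleSystem C) (KParticle.ParticleSystem C) ℝ),
        KParticle.IsProbSet p → KParticle.WeaklyMonotonic p → KParticle.IsKClass p C q →
        KParticle.BoundedBy γ p C → KParticle.IsParticleProcess p C q P →
        ∀ ε : ℝ, 0 < ε → ε ≤ ε₀ →
          (KParticle.mixedTimes P (KParticle.stationary q) ε).Nonempty ∧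
          (KParticle.mixingTime P (KParticle.stationary q) ε : ℝ) ≤
            B * (n : ℝ) ^ (2 * k) * Real.log ε⁻¹) := by
  obtain ⟨u, hu0, hu1, rfl⟩ : ∃ u : ℝ, 0 < u ∧ u < 1 ∧ γ = (u ^ 2)⁻¹ := by
    -- With `u = γ ^ (-1/2)` the decay `γ⁻¹` per unit of height splits into two equal factors.
    refine ⟨(√γ)⁻¹, by positivity, inv_lt_one_of_one_lt₀ (Real.lt_sqrt_of_sq_lt (by simpa)), ?_⟩
    rw [inv_pow, Real.sq_sqrt (by linarith), inv_inv]
  have hu2 : u ^ 2 < 1 := by nlinarith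
  set Λ := KParticle.HeightSystem.relaxation k u with hΛ
  have hΛ1 : 1 ≤ Λ := KParticle.HeightSystem.relaxation_ge_one hu0 hu1
  have hΛ0 : 0 < Λ := by linarith
  set κ := (1 - u ^ 2) / 2 / Λ with hκ
  have hκ0 : 0 < κ := div_pos (by linarith) hΛ0
  have hκ1 : κ ≤ 1 := by rw [hκ, div_le_one hΛ0]; nlinarith
  refine ⟨⟨κ, hκ0, fun n p C q P hp hw hK hB hP => ?_⟩, fun ε₀ hε₀ hε₁ => ?_⟩
  · have hn : 0 < n := hK.pos_of_pos (by omega)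
    have hn' : (1 : ℝ) ≤ n := by exact_mod_cast hn
    obtain ⟨h1, -⟩ := KParticle.particleProcess_gap_and_tvDist hn hp hw hK hu0 hu1 hB hP
    refine le_trans ?_ h1
    rw [← hΛ, ← div_div, ← hκ, div_eq_mul_inv]
    gcongr
    -- The gap is already at least `κ / n`. Since `k ≥ 2` and classes are non-empty, the claimed
    -- denominator is at least `n`.
    have h2 : (n : ℝ) ≤ (n : ℝ) ^ (k - 1) := le_self_pow₀ hn' (by omega)
    refine h2.trans (le_mul_of_one_le_right (by positivity) (Finset.one_le_prod fun i _ => ?_))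
    have hc : 1 ≤ KParticle.classSize C i := by
      obtain ⟨x, hx⟩ := hK.surj i
      exact Finset.card_pos.2 ⟨x, by simpa using hx⟩
    have hc' : (1 : ℝ) ≤ KParticle.classSize C i := by exact_mod_cast hc
    linarith [Real.log_nonneg hn']
  · obtain ⟨B, hB0, hT⟩ := KParticle.exists_time hΛ0 hκ0 hu0 hu1 hε₀ hε₁
    refine ⟨B, hB0, fun n p C q P hp hw hK hB hP ε hε hεε => ?_⟩
    have hn : 0 < n := hK.pos_of_pos (by omega)
    have hn' : (1 : ℝ) ≤ n := by exact_mod_cast hn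
    obtain ⟨-, h2⟩ := KParticle.particleProcess_gap_and_tvDist hn hp hw hK hu0 hu1 hB hP
    rw [← hΛ, ← div_div, ← hκ] at h2
    obtain ⟨T, hTB, hTε⟩ := hT n ε hn ((div_le_one (by linarith)).2 (hκ1.trans hn')) hε hεε
    have hmem : 2 * T ∈ KParticle.mixedTimes P (KParticle.stationary q) ε := by
      intro t ht
      -- Of the `t` steps, `T` are for hitting the ground state; the other `t - T ≥ T` are for
      -- relaxing from it.
      have hsplit : t = (t - T) + T := by omega
      rw [hsplit]
      exact (h2 (t - T) T).trans (hTε (t - T) (by omega))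
    refine ⟨⟨_, hmem⟩, ?_⟩
    have h3 : (KParticle.mixingTime P (KParticle.stationary q) ε : ℝ) ≤ ((2 * T : ℕ) : ℝ) :=
      Nat.cast_le.2 (Nat.sInf_le hmem)
    refine h3.trans (hTB.trans ?_)
    have hlog : 0 ≤ Real.log ε⁻¹ :=
      Real.log_nonneg ((one_le_inv₀ hε).2 (hεε.trans hε₁.le))
    gcongr
    omega
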